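/- Let $(A,\mathfrak m)$ be a commutative Noetherian local ring, let $E := E_A(A/\mathfrak m)$ be the injective envelope of the $A$-module $A/\mathfrak m$, and let $G$ be an Artinian $A$-module of finite injective dimension. Every Artinian injective $A$-module $J$ is isomorphic to $E^n$ for exactly one integer $n \ge 0$; write $\mu^0(\mathfrak m, J)$ for this $n$, the number of copies of $E$ in $J$. (i) The minimal injective resolution of $G$ exists, is finite, and each of its terms is isomorphic to a direct sum of finitely many copies of $E$. If $I^\bullet : 0 \to I^0 \to I^1 \to \cdots \to I^i \to I^{i+1} \to \cdots$ is any finite injective resolution of $G$ (that is, $I^i = 0$ for all large $i$) in which each term is isomorphic to a direct sum of finitely many copies of $E$, then the integer $\sum_{i=0}^{\infty} (-1)^i \mu^0(\mathfrak m, I^i)$ is independent of the choice of such a resolution. This integer is called the Euler number of $G$ and is denoted by $\chi(G)$. (ii) $\chi(G) \ge 0$. (iii) If $G'$ and $\overline G$ are further Artinian $A$-modules of finite injective dimension and there is an exact sequence $0 \to G' \to G \to \overline G \to 0$ of $A$-modules and $A$-homomorphisms, then $\chi(G) = \chi(G') + \chi(\overline G)$. (iv) When $A$ is complete (with respect to the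 $\mathfrak m$-adic topology), the following three conditions are equivalent: (a) $(0 :_A G) \ne 0$; (b) $\chi(G) = 0$; (c) $(0 :_A G)$ contains a non-zerodivisor of $A$. Here $(0 :_A G) = \{a \in A : aG = 0\}$ is the annihilator of $G$. -/

import Mathlib

open CategoryTheory

universe u

/-! ### Essential submodules and injective envelopes -/

/-- The submodule `N` of `M` is essential: it meets every non-zero submodule of `M`
non-trivially. -/
def EssentialSubmodule {A : Type u} [CommRing A] {M : Type u} [AddCommGroup M] [Module A M]
    (N : Submodule A M) : Prop :=
  ∀ P : Submodule A M, P ⊓ N = ⊥ → P = ⊥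

/-- `j : M → E` is an injective envelope of `M`: `E` is injective and `j` is an essential
monomorphism. -/
structure IsInjectiveEnvelope {A : Type u} [CommRing A] {M E : Type u} [AddCommGroup M]
    [Module A M] [AddCommGroup E] [Module A E] (j : M →ₗ[A] E) : Prop where
  isInjective : Module.Injective A E
  injective : Function.Injective j
  essential : EssentialSubmodule (LinearMap.range j)

/-- Every module has an injective envelope. -/
theorem exists_isInjectiveEnvelope (A : Type u) [CommRing A] (M : Type u) [AddCommGroup M]
    [Module A M] : ∃ (E : ModuleCat.{u} A) (j : M →ₗ[A] E), IsInjectiveEnvelope j := by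
  obtain ⟨⟨Q, hQ, ι, hι⟩⟩ := EnoughInjectives.presentation (ModuleCat.of A M)
  have hQ' : Module.Injective A Q := Module.injective_module_of_injective_object A Q
  have hinj : Function.Injective ι.hom := (ModuleCat.mono_iff_injective ι).1 hι
  let M₀ : Submodule A Q := LinearMap.range ι.hom
  -- a maximal essential extension of `M` inside `Q`
  obtain ⟨E, hM₀E, hE⟩ := zorn_le_nonempty₀
    {P : Submodule A Q | M₀ ≤ P ∧ ∀ N ≤ P, N ⊓ M₀ = ⊥ → N = ⊥} (by
      intro c hc hchain y hy
      refine ⟨sSup c, ⟨(hc hy).1.trans (le_sSup hy), ?_⟩, fun z hz => le_sSup hz⟩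
      intro N hN hNM
      rw [Submodule.eq_bot_iff]
      intro x hx
      obtain ⟨P, hP, hxP⟩ :=
        (Submodule.mem_sSup_of_directed ⟨y, hy⟩ hchain.directedOn).1 (hN hx)
      have h1 := (hc hP).2 (Submodule.span A {x}) (by simpa using hxP) (by
        rw [eq_bot_iff, ← hNM]
        exact inf_le_inf_right _ (by simpa using hx))
      simpa using h1) M₀ ⟨le_rfl, fun N hN h => by rwa [inf_eq_left.2 hN] at h⟩
  -- a maximal submodule meeting `E` trivially
  obtain ⟨C, -, hC⟩ := zorn_le_nonempty₀ {P : Submodule A Q | Disjoint E P} (by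
      intro c hc hchain y hy
      refine ⟨sSup c, ?_, fun z hz => le_sSup hz⟩
      exact (hchain.directedOn.disjoint_sSup_right).2 fun b hb => hc hb) ⊥ disjoint_bot_right
  have hCE : Disjoint E C := hC.prop
  obtain ⟨g, hg⟩ := hQ'.out (C.mkQ ∘ₗ E.subtype) (by
      rw [← LinearMap.ker_eq_bot, LinearMap.ker_comp, Submodule.ker_mkQ, Submodule.eq_bot_iff]
      exact fun x hx => Subtype.ext (Submodule.disjoint_def.1 hCE _ x.2 hx)) E.subtype
  let h : Q →ₗ[A] Q := g ∘ₗ C.mkQ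
  have hhE : ∀ x ∈ E, h x = x := fun x hx => hg ⟨x, hx⟩
  have hhC : ∀ x ∈ C, h x = 0 := fun x hx => by
    simp [h, (Submodule.Quotient.mk_eq_zero C).2 hx]
  have hrange : LinearMap.range h ≤ E := by
    refine hE.le_of_ge (y := LinearMap.range h) ⟨?_, ?_⟩ fun x hx => ⟨x, hhE x hx⟩
    · exact fun x hx => ⟨x, hhE x (hE.prop.1 hx)⟩
    · intro N hN hNM
      have hNE : N ⊓ E = ⊥ := hE.prop.2 _ inf_le_right (by
        rw [eq_bot_iff, ← hNM]; exact inf_le_inf_right _ inf_le_left)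
      have hK : N.comap h ≤ C := hC.le_of_ge (y := N.comap h) (by
        refine Submodule.disjoint_def.2 fun x hx hx' => ?_
        have : x ∈ N ⊓ E := ⟨by simpa [hhE x hx] using hx', hx⟩
        simpa [hNE] using this) fun x hx => by simp [hhC x hx]
      rw [Submodule.eq_bot_iff]
      intro n hn
      obtain ⟨q, rfl⟩ := hN hn
      exact hhC q (hK hn)
  let r : Q →ₗ[A] E := h.codRestrict E fun x => hrange ⟨x, rfl⟩
  refine ⟨ModuleCat.of A E, ι.hom.codRestrict E fun x => hM₀E ⟨x, rfl⟩, ⟨⟨?_⟩, ?_, ?_⟩⟩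
  · intro X Y _ _ _ _ f hf φ
    obtain ⟨ψ, hψ⟩ := hQ'.out f hf (E.subtype ∘ₗ φ)
    refine ⟨r ∘ₗ ψ, fun x => Subtype.ext ?_⟩
    change h (ψ (f x)) = φ x
    rw [hψ]
    exact hhE _ (φ x).2
  · intro x y hxy
    exact hinj (congrArg Subtype.val hxy)
  · intro P hP
    have := hE.prop.2 (P.map E.subtype) (Submodule.map_subtype_le E P) (by
      rw [Submodule.eq_bot_iff]
      rintro _ ⟨⟨p, hp, rfl⟩, ⟨m, hm⟩⟩
      have : p ∈ P ⊓ LinearMap.range (ι.hom.codRestrict E fun x => hM₀E ⟨x, rfl⟩) :=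
        ⟨hp, m, Subtype.ext hm⟩
      rw [hP] at this
      rw [(Submodule.mem_bot A).1 this]
      simp)
    exact Submodule.map_injective_of_injective E.injective_subtype (this.trans (Submodule.map_bot _).symm)

/-- `E_A(A/𝔪)`, the injective envelope of the residue field of the local ring `A`. -/
noncomputable def residueEnvelope (A : Type u) [CommRing A] [IsLocalRing A] : ModuleCat.{u} A :=
  (exists_isInjectiveEnvelope A (A ⧸ IsLocalRing.maximalIdeal A)).choose

/-- The embedding of `A/𝔪` in `E_A(A/𝔪)`. -/
noncomputable def residueEnvelopeMap (A : Type u) [CommRing A] [IsLocalRing A] :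
    (A ⧸ IsLocalRing.maximalIdeal A) →ₗ[A] residueEnvelope A :=
  (exists_isInjectiveEnvelope A (A ⧸ IsLocalRing.maximalIdeal A)).choose_spec.choose

theorem residueEnvelopeMap_isInjectiveEnvelope (A : Type u) [CommRing A] [IsLocalRing A] :
    IsInjectiveEnvelope (residueEnvelopeMap A) :=
  (exists_isInjectiveEnvelope A (A ⧸ IsLocalRing.maximalIdeal A)).choose_spec.choose_spec

/-! ### Numbers of copies of `E_A(A/𝔪)` and the Euler number -/

/-- `J` is isomorphic to the direct sum of `n` copies of `E_A(A/𝔪)`. -/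
def IsSumOfCopies (A : Type u) [CommRing A] [IsLocalRing A] (J : Type u) [AddCommGroup J]
    [Module A J] (n : ℕ) : Prop :=
  Nonempty (J ≃ₗ[A] (Fin n → residueEnvelope A))

open Classical in
/-- `μ⁰(𝔪, J)`: the number `n` such that `J` is isomorphic to the direct sum of `n` copies
of `E_A(A/𝔪)` (and `0` if there is no such `n`). -/
noncomputable def numCopies (A : Type u) [CommRing A] [IsLocalRing A] (J : Type u)
    [AddCommGroup J] [Module A J] : ℕ :=
  if h : ∃ n, IsSumOfCopies A J n then Nat.find h else 0

/-- The `A`-module `G` has finite injective dimension. -/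
def FiniteInjectiveDimension (A : Type u) [CommRing A] (G : Type u) [AddCommGroup G]
    [Module A G] : Prop :=
  injectiveDimension (ModuleCat.of A G) ≠ ⊤

section Resolution

variable {A : Type u} [CommRing A] {G : Type u} [AddCommGroup G] [Module A G]

/-- An injective resolution is minimal: for all `i`, the kernel of `Iⁱ → Iⁱ⁺¹` is essential
in `Iⁱ`. -/
def IsMinimalResolution (I : InjectiveResolution (ModuleCat.of A G)) : Prop :=
  ∀ i : ℕ, EssentialSubmodule (LinearMap.ker (I.cocomplex.d i (i + 1)).hom)

/-- An injective resolution is finite and each of its terms is isomorphic to a (finite)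
direct sum of copies of `E_A(A/𝔪)`. -/
structure IsFiniteResolutionByCopies [IsLocalRing A]
    (I : InjectiveResolution (ModuleCat.of A G)) : Prop where
  finite : ∃ N : ℕ, ∀ i : ℕ, N < i → Subsingleton (I.cocomplex.X i)
  copies : ∀ i : ℕ, ∃ n : ℕ, IsSumOfCopies A (I.cocomplex.X i) n

/-- The alternating sum `∑ᵢ (-1)ⁱ μ⁰(𝔪, Iⁱ)`; all but finitely many terms vanish when the
resolution is finite. -/
noncomputable def alternatingSum [IsLocalRing A]
    (I : InjectiveResolution (ModuleCat.of A G)) : ℤ :=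
  ∑ᶠ i : ℕ, (-1 : ℤ) ^ i * (numCopies A (I.cocomplex.X i) : ℤ)

end Resolution

open Classical in
/-- The Euler number `χ_A(G)`: the alternating sum computed from some finite injective
resolution of `G` by finite direct sums of copies of `E_A(A/𝔪)` (and `0` if there is none). -/
noncomputable def eulerNumber (A : Type u) [CommRing A] [IsLocalRing A] (G : Type u)
    [AddCommGroup G] [Module A G] : ℤ :=
  if h : ∃ I : InjectiveResolution (ModuleCat.of A G), IsFiniteResolutionByCopies I then
    alternatingSum h.choose
  else 0

open IsLocalRing

/-! ### Injective envelopes -/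

section Envelopes

variable {A : Type u} [CommRing A] {M N P V : Type u} [AddCommGroup M] [Module A M]
  [AddCommGroup N] [Module A N] [AddCommGroup P] [Module A P] [AddCommGroup V] [Module A V]

/-! By Matlis duality the statement becomes one about ranks of free modules. Let `E` be the envelope
of the residue field and `S` its endomorphism ring. Each element of `E` is killed by a power of `𝔪`,
and on the part killed by `𝔪ⁿ` every endomorphism is multiplication by an element of `A`
(`IsInjectiveEnvelope.exists_smul_eq`, by counting lengths). Hence `S` is commutative, and it is `A`
itself when `A` is complete. The functor `Hom_A(-, E)` is exact and sends `Eⁿ` to `Sⁿ`, so a finite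
resolution of `G` by copies of `E` dualizes to a finite free resolution over `S`.

Localize at a prime `p` of `S` such that every finite subset of the maximal ideal of `S_p` is killed
by a non-zero element. Over `S_p` an injection of finite free modules stays injective modulo the
maximal ideal, so its cokernel is free (`IsLocalRing.FinsetsAnnihilated.free_of_exact`). The dual of
`G` thus localizes to a free module whose rank is the alternating sum
(`IsFiniteResolutionByCopies.isDualFreeOfRank`). A rank depends on `G` alone, is non-negative, and
is additive; for this a minimal prime of `S` suffices.

For complete `A` all associated primes of `A` are used. A non-zero element killing `G` survives in
the localization at one of them, which forces rank zero. Conversely, if the Euler number is zero, no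
associated prime lies in the support of the dual, which is finitely generated with the same
annihilator as `G`; prime avoidance then gives a non-zerodivisor in that annihilator.

Resolutions exist because `E` is Artinian (Melkersson's criterion) and an injective module with an
essential Artinian submodule is some `Eⁿ`; a minimal resolution stops soon after a cocycle module
becomes injective. -/

theorem EssentialSubmodule.injective {W : Submodule A M} (hW : EssentialSubmodule W)
    (f : M →ₗ[A] N) (hf : ∀ x ∈ W, f x = 0 → x = 0) : Function.Injective f := by
  rw [← LinearMap.ker_eq_bot]
  refine hW _ ((Submodule.eq_bot_iff _).2 fun x hx => hf x hx.2 hx.1)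

theorem EssentialSubmodule.exists_ne_zero {W : Submodule A M} (hW : EssentialSubmodule W)
    {Q : Submodule A M} (hQ : Q ≠ ⊥) : ∃ x ∈ Q, x ∈ W ∧ x ≠ 0 := by
  obtain ⟨x, hx, hx0⟩ := Submodule.exists_mem_ne_zero_of_ne_bot (mt (hW Q) hQ)
  exact ⟨x, hx.1, hx.2, hx0⟩

theorem essentialSubmodule_of_exists {W : Submodule A M}
    (h : ∀ x : M, x ≠ 0 → ∃ a : A, a • x ≠ 0 ∧ a • x ∈ W) : EssentialSubmodule W := by
  intro Q hQ
  by_contra hne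
  obtain ⟨x, hx, hx0⟩ := Submodule.exists_mem_ne_zero_of_ne_bot hne
  obtain ⟨a, ha0, ha⟩ := h x hx0
  have : a • x ∈ Q ⊓ W := ⟨Q.smul_mem a hx, ha⟩
  rw [hQ] at this
  exact ha0 this

/-- An injective map out of an injective module is onto as soon as its range contains an
essential submodule. -/
theorem surjective_of_essentialSubmodule_le_range (hM : Module.Injective A M) {f : M →ₗ[A] N}
    (hf : Function.Injective f) {W : Submodule A N} (hW : EssentialSubmodule W)
    (hle : W ≤ LinearMap.range f) : Function.Surjective f := by
  obtain ⟨r, hr⟩ := hM.out f hf LinearMap.id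
  have hrinj : Function.Injective r := hW.injective r fun x hx hx0 => by
    obtain ⟨y, rfl⟩ := hle hx
    rw [hr] at hx0
    simp_all
  intro y
  refine ⟨r y, hrinj ?_⟩
  rw [hr]; rfl

/-- An essential submodule which is an injective module is everything. -/
theorem EssentialSubmodule.eq_top {W : Submodule A M} (hW : EssentialSubmodule W)
    (hinj : Module.Injective A W) : W = ⊤ := by
  have := surjective_of_essentialSubmodule_le_range hinj W.injective_subtype hW (by simp)
  rw [← W.range_subtype]
  exact LinearMap.range_eq_top.2 this

/-- Injective envelopes are unique up to isomorphism. -/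
theorem IsInjectiveEnvelope.nonempty_equiv {i : V →ₗ[A] M} {j : V →ₗ[A] N}
    (hi : IsInjectiveEnvelope i) (hj : IsInjectiveEnvelope j) : Nonempty (M ≃ₗ[A] N) := by
  obtain ⟨f, hf⟩ := hj.isInjective.out i hi.injective j
  have hfinj : Function.Injective f := hi.essential.injective f fun x hx hx0 => by
    obtain ⟨v, rfl⟩ := hx
    rw [hf] at hx0
    have : v = 0 := hj.injective (by simpa using hx0)
    simp [this]
  refine ⟨LinearEquiv.ofBijective f ⟨hfinj, ?_⟩⟩
  refine surjective_of_essentialSubmodule_le_range hi.isInjective hfinj hj.essential ?_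
  rintro _ ⟨v, rfl⟩
  exact ⟨i v, hf v⟩

theorem IsInjectiveEnvelope.comp_equiv {i : V →ₗ[A] M} (hi : IsInjectiveEnvelope i)
    (e : P ≃ₗ[A] V) : IsInjectiveEnvelope (i ∘ₗ e.toLinearMap) :=
  ⟨hi.isInjective, hi.injective.comp e.injective, by
    rw [LinearMap.range_comp_of_range_eq_top _ e.range]; exact hi.essential⟩

end Envelopes

/-! ### Modules in which every element is killed by a power of an ideal -/

/-- Every element of `M` is killed by a power of `I`. -/
def IsPowerTorsion {A : Type u} [CommRing A] (I : Ideal A) (M : Type u) [AddCommGroup M]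
    [Module A M] : Prop :=
  ∀ x : M, ∃ n : ℕ, ∀ a ∈ I ^ n, a • x = 0

section PowerTorsion

variable {A : Type u} [CommRing A] {M : Type u} [AddCommGroup M] [Module A M] {I : Ideal A}

/-- Take the least power of `I` killing `x` and an element of the preceding power that does not.
This makes the elements killed by `I` an essential submodule. -/
theorem IsPowerTorsion.exists_smul (h : IsPowerTorsion I M) {x : M} (hx : x ≠ 0) :
    ∃ a : A, a • x ≠ 0 ∧ ∀ b ∈ I, b • a • x = 0 := by
  classical
  set n := Nat.find (h x) with hn
  have hspec : ∀ a ∈ I ^ n, a • x = 0 := Nat.find_spec (h x)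
  rcases Nat.eq_zero_or_pos n with h0 | hpos
  · rw [h0] at hspec
    exact absurd (by simpa using hspec 1 (by simp)) hx
  · have := Nat.find_min (h x) (m := n - 1) (by omega)
    push Not at this
    obtain ⟨a, ha, hax⟩ := this
    refine ⟨a, hax, fun b hb => ?_⟩
    rw [smul_smul]
    refine hspec _ ?_
    have : n = (n - 1) + 1 := by omega
    rw [this, pow_succ, mul_comm b a]
    exact Ideal.mul_mem_mul ha hb

theorem IsPowerTorsion.pi {n : ℕ} (h : IsPowerTorsion I M) : IsPowerTorsion I (Fin n → M) := by
  intro x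
  choose m hm using fun i => h (x i)
  refine ⟨Finset.univ.sup m, fun a ha => funext fun i => hm i a ?_⟩
  exact Ideal.pow_le_pow_right (Finset.le_sup (Finset.mem_univ i)) ha

/-- One variable case of Melkersson's criterion. -/
theorem isArtinian_of_isArtinian_torsionBy (a : A) (h : ∀ x : M, ∃ n : ℕ, a ^ n • x = 0)
    [hA : IsArtinian A (Submodule.torsionBy A M a)] : IsArtinian A M := by
  -- `L n i = aⁿ (Nᵢ ∩ (0 : aⁿ⁺¹))`
  let L : ℕ → Submodule A M → Submodule A (Submodule.torsionBy A M a) := fun n N =>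
    ((N ⊓ Submodule.torsionBy A M (a ^ (n + 1))).map (LinearMap.lsmul A M (a ^ n))).comap
      (Submodule.subtype _)
  have hLmono : ∀ n {N N' : Submodule A M}, N ≤ N' → L n N ≤ L n N' := fun n N N' hN =>
    Submodule.comap_mono (Submodule.map_mono (inf_le_inf_right _ hN))
  have hLanti : ∀ (N : Submodule A M) n, L (n + 1) N ≤ L n N := by
    rintro N n ⟨x, hx⟩ ⟨y, ⟨hyN, hy⟩, hyx⟩
    refine ⟨a • y, ⟨N.smul_mem a hyN, ?_⟩, ?_⟩
    · simp only [SetLike.mem_coe, Submodule.mem_torsionBy_iff] at hy ⊢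
      rw [smul_smul, ← pow_succ]; exact hy
    · simp only [LinearMap.lsmul_apply, Submodule.subtype_apply] at hyx ⊢
      rw [smul_smul, ← pow_succ]; exact hyx
  have hLanti' : ∀ (N : Submodule A M), Antitone (fun n => L n N) := fun N =>
    antitone_nat_of_succ_le (hLanti N)
  -- The `L n` jointly detect inclusion: by induction on the power of `a` killing `x`, subtract an
  -- element of `N'` with the same image under the preceding power.
  have hLeq : ∀ N N' : Submodule A M, N' ≤ N → (∀ n, L n N ≤ L n N') → N ≤ N' := by
    intro N N' hle hL
    have key : ∀ n, ∀ x ∈ N, a ^ n • x = 0 → x ∈ N' := by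
      intro n
      induction n with
      | zero => intro x _ hx; rw [pow_zero, one_smul] at hx; rw [hx]; exact N'.zero_mem
      | succ n ih =>
        intro x hx hx0
        have hmem : a ^ n • x ∈ Submodule.torsionBy A M a := by
          rw [Submodule.mem_torsionBy_iff, smul_smul, ← pow_succ']; exact hx0
        obtain ⟨y, ⟨hyN, hy⟩, hyx⟩ := hL n (show (⟨_, hmem⟩ : Submodule.torsionBy A M a) ∈ L n N from
          ⟨x, ⟨hx, by simpa using hx0⟩, rfl⟩)
        simp only [LinearMap.lsmul_apply, Submodule.subtype_apply] at hyx
        have := ih (x - y) (N.sub_mem hx (hle hyN)) (by rw [smul_sub, hyx, sub_self])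
        simpa using N'.add_mem this hyN
    intro x hx
    obtain ⟨n, hn⟩ := h x
    exact key n x hx hn
  rw [← monotone_stabilizes_iff_artinian]
  intro f
  have hf : ∀ {i j}, i ≤ j → OrderDual.ofDual (f j) ≤ OrderDual.ofDual (f i) :=
    fun hij => f.monotone hij
  set N : ℕ → Submodule A M := fun i => OrderDual.ofDual (f i) with hN
  have stab := fun g => (monotone_stabilizes_iff_artinian (R := A)
    (M := Submodule.torsionBy A M a)).2 hA g
  -- The diagonal chain, stable from `d` on, controls all `n ≥ d` at once; the finitely many `n < d`
  -- are stabilized one by one by `e`.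
  obtain ⟨d, hd⟩ := stab ⟨fun i => OrderDual.toDual (L i (N i)), fun i j hij =>
    (hLanti' _ hij).trans (hLmono _ (hf hij))⟩
  have hd' : ∀ i, d ≤ i → L d (N d) = L i (N i) := hd
  choose e he using fun n => stab ⟨fun i => OrderDual.toDual (L n (N i)), fun i j hij =>
    hLmono _ (hf hij)⟩
  have he' : ∀ n i, e n ≤ i → L n (N (e n)) = L n (N i) := he
  refine ⟨max d ((Finset.range d).sup e), fun m hm => ?_⟩
  have hdm : d ≤ max d ((Finset.range d).sup e) := le_max_left _ _
  set c := max d ((Finset.range d).sup e)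
  refine le_antisymm (f.monotone hm) ?_
  refine hLeq (N c) (N m) (hf hm) fun n => ?_
  rcases lt_or_ge n d with hnd | hnd
  · have hen : e n ≤ c := (Finset.le_sup (f := e) (Finset.mem_range.2 hnd)).trans (le_max_right _ _)
    rw [← he' n c hen, ← he' n m (hen.trans hm)]
  -- `L` decreases in both indices, so this value is squeezed against the constant diagonal at `max
  -- n m`.
  · calc L n (N c) ≤ L d (N d) := (hLanti' _ hnd).trans (hLmono _ (hf hdm))
      _ = L (max n m) (N (max n m)) := hd' _ (hnd.trans (le_max_left _ _))
      _ ≤ L n (N (max n m)) := hLanti' _ (le_max_left _ _)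
      _ ≤ L n (N m) := hLmono _ (hf (le_max_right _ _))

/-- **Melkersson's criterion**, for an ideal with given finite set of generators. -/
theorem isArtinian_of_isArtinian_torsionBySet (s : Finset A) :
    ∀ (M : Type u) [AddCommGroup M] [Module A M],
      (∀ a ∈ s, ∀ x : M, ∃ n : ℕ, a ^ n • x = 0) →
      IsArtinian A (Submodule.torsionBySet A M (s : Set A)) → IsArtinian A M := by
  classical
  induction s using Finset.induction_on with
  | empty =>
    intro M _ _ _ hM
    exact isArtinian_of_injective (LinearMap.codRestrict
      (Submodule.torsionBySet A M ((∅ : Finset A) : Set A)) LinearMap.id (by simp))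
      (fun x y h => congrArg (Submodule.subtype _) h)
  | insert a s has ih =>
    intro M _ _ h hM
    have : IsArtinian A (Submodule.torsionBy A M a) := by
      refine ih _ (fun b hb x => ?_) ?_
      · obtain ⟨n, hn⟩ := h b (Finset.mem_insert_of_mem hb) x
        exact ⟨n, Subtype.ext hn⟩
      · refine isArtinian_of_injective (LinearMap.codRestrict
          (Submodule.torsionBySet A M ((insert a s : Finset A) : Set A))
          ((Submodule.subtype _).comp (Submodule.subtype _)) ?_) ?_
        · rintro ⟨⟨x, hx⟩, hx'⟩
          rw [Submodule.mem_torsionBySet_iff] at hx' ⊢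
          rintro ⟨b, hb⟩
          rw [Finset.mem_coe, Finset.mem_insert] at hb
          rcases hb with rfl | hb
          · exact hx
          · exact congrArg Subtype.val (hx' ⟨b, hb⟩)
        · intro x y hxy
          have := congrArg (Submodule.torsionBySet A M ((insert a s : Finset A) : Set A)).subtype hxy
          exact Subtype.ext (Subtype.ext this)
    exact isArtinian_of_isArtinian_torsionBy a (h a (Finset.mem_insert_self a s))

/-- **Melkersson's criterion**: over a Noetherian ring, a module whose elements are killed by
powers of `I` is Artinian if the submodule of elements killed by `I` is. -/
theorem IsPowerTorsion.isArtinian [IsNoetherianRing A] (h : IsPowerTorsion I M)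
    (hI : IsArtinian A (Submodule.torsionBySet A M (I : Set A))) : IsArtinian A M := by
  obtain ⟨s, rfl⟩ := IsNoetherian.noetherian I
  refine isArtinian_of_isArtinian_torsionBySet s M (fun a ha x => ?_) ?_
  · obtain ⟨n, hn⟩ := h x
    exact ⟨n, hn _ (Ideal.pow_mem_pow (Submodule.subset_span ha) n)⟩
  · rwa [← Submodule.torsionBySet_eq_torsionBySet_span] at hI

end PowerTorsion

/-! ### The injective envelope of the residue field -/

section ResidueEnvelope

variable {A : Type u} [CommRing A] [IsLocalRing A] {E : Type u} [AddCommGroup E] [Module A E]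
  {j : (A ⧸ maximalIdeal A) →ₗ[A] E}

theorem isSimpleModule_residue : IsSimpleModule A (A ⧸ maximalIdeal A) :=
  isSimpleModule_iff_isCoatom.2 (maximalIdeal.isMaximal A).out

theorem smul_eq_zero_of_mem_maximalIdeal (j : (A ⧸ maximalIdeal A) →ₗ[A] E) {a : A}
    (ha : a ∈ maximalIdeal A) (v : A ⧸ maximalIdeal A) : a • j v = 0 := by
  rw [← map_smul]
  obtain ⟨b, rfl⟩ := Ideal.Quotient.mk_surjective v
  have : a • (Ideal.Quotient.mk (maximalIdeal A) b) = 0 :=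
    Ideal.Quotient.eq_zero_iff_mem.2 (Ideal.mul_mem_right _ _ ha)
  rw [this, map_zero]

/-- By Artin–Rees on `Ax`, some power of `𝔪` times `Ax` meets the residue field inside `𝔪` times the
residue field, which is zero. Essentiality then makes that power kill `x`. -/
theorem IsInjectiveEnvelope.isPowerTorsion [IsNoetherianRing A] (h : IsInjectiveEnvelope j) :
    IsPowerTorsion (maximalIdeal A) E := by
  intro x
  set B : Submodule A E := Submodule.span A {x}
  set K : Submodule A B := (LinearMap.range j).comap B.subtype
  obtain ⟨k, hk⟩ := Ideal.exists_pow_inf_eq_pow_smul (maximalIdeal A) K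
  have h1 := hk (k + 1) (by omega)
  have h2 : (maximalIdeal A ^ (k + 1) • ⊤ : Submodule A B) ⊓ K = ⊥ := by
    rw [h1, eq_bot_iff, Nat.add_sub_cancel_left, pow_one, Submodule.smul_le]
    rintro a ha ⟨y, hy⟩ ⟨-, v, hv⟩
    rw [Submodule.mem_bot]
    refine Subtype.ext ?_
    have hv' : j v = y := hv
    change a • y = 0
    rw [← hv']
    exact smul_eq_zero_of_mem_maximalIdeal j ha v
  have h3 : (maximalIdeal A ^ (k + 1) • ⊤ : Submodule A B).map B.subtype = ⊥ := by
    refine h.essential _ ?_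
    rw [Submodule.eq_bot_iff]
    rintro _ ⟨⟨y, hy, rfl⟩, hyj⟩
    have : y ∈ (maximalIdeal A ^ (k + 1) • ⊤ : Submodule A B) ⊓ K := ⟨hy, hyj⟩
    rw [h2] at this
    rw [(Submodule.mem_bot A).1 this]; simp
  refine ⟨k + 1, fun a ha => ?_⟩
  have : a • x ∈ (maximalIdeal A ^ (k + 1) • ⊤ : Submodule A B).map B.subtype :=
    ⟨a • ⟨x, Submodule.mem_span_singleton_self x⟩,
      Submodule.smul_mem_smul ha Submodule.mem_top, rfl⟩
  rw [h3] at this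
  simpa using this

/-- The socle of `E` is no larger than the residue field: essentiality puts a non-zero multiple `a •
x` in it, and `a` must be a unit because `𝔪` kills `x`. -/
theorem IsInjectiveEnvelope.exists_of_smul_eq_zero (h : IsInjectiveEnvelope j) {x : E}
    (hx : ∀ a ∈ maximalIdeal A, a • x = 0) : ∃ v, j v = x := by
  by_cases hx0 : x = 0
  · exact ⟨0, by simp [hx0]⟩
  obtain ⟨y, hy, ⟨v, hv⟩, hy0⟩ := h.essential.exists_ne_zero
    (Q := Submodule.span A {x}) (by simpa using hx0)
  obtain ⟨a, rfl⟩ := Submodule.mem_span_singleton.1 hy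
  have hau : IsUnit a := by
    by_contra hna
    exact hy0 (hx a ((mem_maximalIdeal a).2 hna))
  obtain ⟨u, rfl⟩ := hau
  refine ⟨(↑u⁻¹ : A) • v, ?_⟩
  rw [map_smul, hv, smul_smul, Units.inv_mul, one_smul]

theorem IsInjectiveEnvelope.isArtinian [IsNoetherianRing A] (h : IsInjectiveEnvelope j) :
    IsArtinian A E := by
  refine h.isPowerTorsion.isArtinian ?_
  have := isSimpleModule_residue (A := A)
  refine isArtinian_of_surjective (A ⧸ maximalIdeal A) (LinearMap.codRestrict
    (Submodule.torsionBySet A E (maximalIdeal A : Set A)) j fun v => ?_) ?_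
  · rw [Submodule.mem_torsionBySet_iff]
    exact fun a => smul_eq_zero_of_mem_maximalIdeal j a.2 v
  · rintro ⟨x, hx⟩
    obtain ⟨v, hv⟩ := h.exists_of_smul_eq_zero fun a ha =>
      (Submodule.mem_torsionBySet_iff _ _).1 hx ⟨a, ha⟩
    exact ⟨v, Subtype.ext hv⟩

/-- The diagonal map `kⁿ → Eⁿ` is an injective envelope. -/
theorem IsInjectiveEnvelope.pi [IsNoetherianRing A] (h : IsInjectiveEnvelope j) (n : ℕ) :
    IsInjectiveEnvelope (j.compLeft (Fin n)) := by
  have := h.isInjective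
  refine ⟨inferInstance, fun x y hxy => funext fun i => h.injective (congrFun hxy i), ?_⟩
  refine essentialSubmodule_of_exists fun x hx => ?_
  obtain ⟨a, ha0, ha⟩ := (h.isPowerTorsion.pi (n := n)).exists_smul hx
  refine ⟨a, ha0, ?_⟩
  choose v hv using fun i => h.exists_of_smul_eq_zero
    (x := (a • x) i) (fun b hb => congrFun (ha b hb) i)
  exact ⟨v, funext hv⟩

/-- The elements killed by `𝔪` form an essential submodule of an Artinian module. -/
theorem exists_mem_ne_zero_of_isArtinian {M : Type u} [AddCommGroup M] [Module A M]
    {Q : Submodule A M} [IsArtinian A Q] (hQ : Q ≠ ⊥) :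
    ∃ x ∈ Q, x ≠ 0 ∧ ∀ a ∈ maximalIdeal A, a • x = 0 := by
  have : Nontrivial Q := Submodule.nontrivial_iff_ne_bot.2 hQ
  obtain ⟨S, hS⟩ := IsAtomic.exists_atom (Submodule A Q)
  have hsimple : IsSimpleModule A S := isSimpleModule_iff_isAtom.2 hS
  have hann : Module.annihilator A S = maximalIdeal A :=
    eq_maximalIdeal IsSimpleModule.annihilator_isMaximal
  obtain ⟨x, hx, hx0⟩ := Submodule.exists_mem_ne_zero_of_ne_bot hS.1
  refine ⟨x, x.2, by simpa using hx0, fun a ha => ?_⟩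
  rw [← hann] at ha
  simpa using congrArg (Q.subtype ∘ₗ S.subtype) (Module.mem_annihilator.1 ha ⟨x, hx⟩)

/-- An injective module with an essential Artinian submodule is a finite direct sum of copies of
the injective envelope of the residue field. -/
theorem IsInjectiveEnvelope.exists_equiv_pi [IsNoetherianRing A] (h : IsInjectiveEnvelope j)
    {M : Type u} [AddCommGroup M] [Module A M] (hM : Module.Injective A M) {Z : Submodule A M}
    [IsArtinian A Z] (hZ : EssentialSubmodule Z) : ∃ n : ℕ, Nonempty (M ≃ₗ[A] (Fin n → E)) := by
  -- `W` is the socle of `Z`: essential in `M`, and an Artinian, hence finite-dimensional, space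
  -- over the residue field. So `M` and a power of `E` are both envelopes of `W`.
  set W : Submodule A M := Z ⊓ Submodule.torsionBySet A M (maximalIdeal A : Set A)
  have hW : EssentialSubmodule W := by
    intro Q hQ
    by_contra hne
    have : IsArtinian A (Q ⊓ Z : Submodule A M) :=
      isArtinian_of_injective (Submodule.inclusion (inf_le_right : Q ⊓ Z ≤ Z))
        (Submodule.inclusion_injective _)
    obtain ⟨x, hx, hx0, hxm⟩ := exists_mem_ne_zero_of_isArtinian (mt (hZ Q) hne)
    have : x ∈ Q ⊓ W :=
      ⟨hx.1, hx.2, (Submodule.mem_torsionBySet_iff _ _).2 fun a => hxm a a.2⟩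
    rw [hQ] at this
    exact hx0 this
  have hWt : Module.IsTorsionBySet A W (maximalIdeal A : Set A) := fun x a =>
    Subtype.ext ((Submodule.mem_torsionBySet_iff _ _).1 x.2.2 a)
  let : Module (A ⧸ maximalIdeal A) W := hWt.module
  have : IsScalarTower A (A ⧸ maximalIdeal A) W := hWt.isScalarTower
  let : Field (A ⧸ maximalIdeal A) := Ideal.Quotient.field _
  have hArt : IsArtinian A W := isArtinian_of_injective
    (Submodule.inclusion (inf_le_left : W ≤ Z)) (Submodule.inclusion_injective _)
  have : IsArtinian (A ⧸ maximalIdeal A) W := isArtinian_of_tower A hArt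
  have : Module.Finite (A ⧸ maximalIdeal A) W := (IsSemisimpleModule.finite_tfae.out 2 0).1 this
  let e : W ≃ₗ[A] (Fin (Module.finrank (A ⧸ maximalIdeal A) W) → A ⧸ maximalIdeal A) :=
    (Module.finBasis (A ⧸ maximalIdeal A) W).equivFun.restrictScalars A
  have hi : IsInjectiveEnvelope W.subtype :=
    ⟨hM, W.injective_subtype, by rw [W.range_subtype]; exact hW⟩
  exact ⟨_, hi.nonempty_equiv ((h.pi _).comp_equiv e)⟩

/-- `E` is a cogenerator. -/
theorem IsInjectiveEnvelope.exists_apply_ne_zero (h : IsInjectiveEnvelope j)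
    {M : Type u} [AddCommGroup M] [Module A M] {x : M} (hx : x ≠ 0) :
    ∃ f : M →ₗ[A] E, f x ≠ 0 := by
  -- `Ax` is `A/I` and maps onto the residue field inside `E`; injectivity of `E` extends this map
  -- to `M`.
  set I : Ideal A := LinearMap.ker (LinearMap.toSpanSingleton A M x)
  have hI : I ≤ maximalIdeal A := le_maximalIdeal fun htop => hx <| by
    have : (1 : A) ∈ I := by rw [htop]; trivial
    simpa [I] using this
  let ι : (A ⧸ I) →ₗ[A] M := I.liftQ (LinearMap.toSpanSingleton A M x) le_rfl
  have hι : Function.Injective ι := LinearMap.ker_eq_bot.1 (Submodule.ker_liftQ_eq_bot' _ _ rfl)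
  obtain ⟨f, hf⟩ := h.isInjective.out ι hι (j ∘ₗ Submodule.factor hI)
  refine ⟨f, ?_⟩
  have h1 : ι (Submodule.Quotient.mk 1) = x :=
    (I.liftQ_apply _ _).trans (one_smul A x)
  have h2 := hf (Submodule.Quotient.mk 1)
  rw [h1] at h2
  rw [h2]
  intro h0
  have h3 : (Submodule.Quotient.mk (1 : A) : A ⧸ maximalIdeal A) = 0 := h.injective (by simpa using h0)
  rw [Submodule.Quotient.mk_eq_zero] at h3
  exact (maximalIdeal.isMaximal A).ne_top ((Ideal.eq_top_iff_one _).2 h3)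

end ResidueEnvelope

/-! ### Endomorphisms of the injective envelope of the residue field -/

/-- `Hom(-, E)` is exact when `E` is injective, on the left end. -/
theorem Module.Injective.lcomp_surjective {A : Type u} [CommRing A] {E M N : Type u}
    [AddCommGroup E] [Module A E] [AddCommGroup M] [Module A M] [AddCommGroup N] [Module A N]
    (hE : Module.Injective A E) {f : M →ₗ[A] N} (hf : Function.Injective f) :
    Function.Surjective (LinearMap.lcomp A E f) := fun φ => by
  obtain ⟨ψ, hψ⟩ := hE.out f hf φ
  exact ⟨ψ, LinearMap.ext hψ⟩

theorem surjective_of_injective_of_length_eq {A : Type u} [CommRing A] {M N : Type u} [AddCommGroup M] [Module A M]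
    [AddCommGroup N] [Module A N] (hM : IsFiniteLength A M)
    (hlen : Module.length A M = Module.length A N) {f : M →ₗ[A] N} (hf : Function.Injective f) :
    Function.Surjective f := by
  have h1 := Module.length_eq_add_of_exact f (LinearMap.range f).mkQ hf
    (Submodule.mkQ_surjective _) (LinearMap.exact_map_mkQ_range f)
  rw [← hlen] at h1
  have h2 : Module.length A (N ⧸ LinearMap.range f) = 0 := by
    have hne := Module.length_ne_top_iff.2 hM
    exact WithTop.add_left_cancel hne (h1.symm.trans (add_zero _).symm)
  rw [Module.length_eq_zero_iff, Submodule.Quotient.subsingleton_iff] at h2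
  exact LinearMap.range_eq_top.1 h2

section Endomorphisms

variable {A : Type u} [CommRing A] [IsLocalRing A] {E : Type u} [AddCommGroup E] [Module A E]
  {j : (A ⧸ maximalIdeal A) →ₗ[A] E}

/-- Evaluation at a non-zero `s` embeds the dual in the socle of `E`, of length one; the dual is
non-zero since `E` is a cogenerator. -/
theorem IsInjectiveEnvelope.length_dual_of_isSimpleModule (h : IsInjectiveEnvelope j)
    (M : Type u) [AddCommGroup M] [Module A M] [IsSimpleModule A M] :
    Module.length A (M →ₗ[A] E) = 1 := by
  have hann : Module.annihilator A M = maximalIdeal A :=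
    eq_maximalIdeal IsSimpleModule.annihilator_isMaximal
  have := IsSimpleModule.nontrivial A M
  obtain ⟨s, hs⟩ := exists_ne (0 : M)
  refine le_antisymm ?_ ?_
  · have hmem : ∀ f : M →ₗ[A] E, f s ∈ LinearMap.range j := fun f =>
      h.exists_of_smul_eq_zero fun a ha => by
        rw [← hann] at ha
        rw [← map_smul, Module.mem_annihilator.1 ha s, map_zero]
    let ev : (M →ₗ[A] E) →ₗ[A] LinearMap.range j :=
      (LinearMap.applyₗ s).codRestrict _ hmem
    have hev : Function.Injective ev := by
      rw [← LinearMap.ker_eq_bot, Submodule.eq_bot_iff]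
      intro f hf
      have hfs : f s = 0 := congrArg Subtype.val (LinearMap.mem_ker.1 hf)
      have hker : LinearMap.ker f = ⊤ := by
        refine (eq_bot_or_eq_top _).resolve_left fun hb => hs ?_
        have : s ∈ LinearMap.ker f := hfs
        rwa [hb, Submodule.mem_bot] at this
      exact LinearMap.ker_eq_top.1 hker
    refine (Module.length_le_of_injective ev hev).trans ?_
    rw [← (LinearEquiv.ofInjective j h.injective).length_eq]
    have := isSimpleModule_residue (A := A)
    rw [Module.length_eq_one]
  · obtain ⟨f, hf⟩ := h.exists_apply_ne_zero hs
    have : Nontrivial (M →ₗ[A] E) := ⟨f, 0, fun h0 => hf (by rw [h0]; rfl)⟩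
    exact Order.one_le_iff_pos.2 Module.length_pos

theorem IsInjectiveEnvelope.length_dual (h : IsInjectiveEnvelope j)
    {M : Type u} [AddCommGroup M] [Module A M] (hM : IsFiniteLength A M) :
    Module.length A (M →ₗ[A] E) = Module.length A M := by
  induction hM with
  | of_subsingleton => rw [Module.length_eq_zero, Module.length_eq_zero]
  | @of_simple_quotient M _ _ N hS _ ih =>
    rw [Module.length_eq_add_of_exact N.subtype N.mkQ N.injective_subtype N.mkQ_surjective
        (LinearMap.exact_subtype_mkQ N),
      Module.length_eq_add_of_exact (LinearMap.lcomp A E N.mkQ) (LinearMap.lcomp A E N.subtype)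
        (LinearMap.lcomp_injective_of_surjective _ N.mkQ_surjective)
        (h.isInjective.lcomp_surjective N.injective_subtype)
        (LinearMap.exact_lcomp_of_exact_of_surjective E (LinearMap.exact_subtype_mkQ N)
          N.mkQ_surjective), ih, h.length_dual_of_isSimpleModule (M ⧸ N), Module.length_eq_one A (M ⧸ N), add_comm]

theorem isFiniteLength_quotient_pow [IsNoetherianRing A] (n : ℕ) :
    IsFiniteLength A (A ⧸ maximalIdeal A ^ n) := by
  rw [isFiniteLength_iff_isNoetherian_isArtinian]
  refine ⟨inferInstance, ?_⟩
  have hpt : IsPowerTorsion (maximalIdeal A) (A ⧸ maximalIdeal A ^ n) := fun x => by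
    obtain ⟨b, rfl⟩ := Ideal.Quotient.mk_surjective x
    exact ⟨n, fun a ha => Ideal.Quotient.eq_zero_iff_mem.2 (Ideal.mul_mem_right b _ ha)⟩
  refine hpt.isArtinian ?_
  set W := Submodule.torsionBySet A (A ⧸ maximalIdeal A ^ n) (maximalIdeal A : Set A)
  have hWt : Module.IsTorsionBySet A W (maximalIdeal A : Set A) :=
    Submodule.torsionBySet_isTorsionBySet _
  let : Module (A ⧸ maximalIdeal A) W := hWt.module
  have : IsScalarTower A (A ⧸ maximalIdeal A) W := hWt.isScalarTower
  let : Field (A ⧸ maximalIdeal A) := Ideal.Quotient.field _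
  have : Module.Finite (A ⧸ maximalIdeal A) W := Module.Finite.of_restrictScalars_finite A _ _
  have hk : IsArtinian (A ⧸ maximalIdeal A) W := inferInstance
  exact isArtinian_of_surjective_algebraMap (S := A) (R := A ⧸ maximalIdeal A)
    Ideal.Quotient.mk_surjective

/-- Any linear map to `E` from the elements of `E` killed by `𝔪ⁿ` is multiplication by a scalar. -/
theorem IsInjectiveEnvelope.exists_smul_eq [IsNoetherianRing A] (h : IsInjectiveEnvelope j)
    (n : ℕ) (f : E →ₗ[A] E) :
    ∃ a : A, ∀ x : E, (∀ b ∈ maximalIdeal A ^ n, b • x = 0) → f x = a • x := by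
  set I : Ideal A := maximalIdeal A ^ n
  have hB : IsFiniteLength A (A ⧸ I) := isFiniteLength_quotient_pow n
  set W := Submodule.torsionBySet A E (I : Set A)
  have hW : ∀ x : E, x ∈ W ↔ ∀ b ∈ I, b • x = 0 := fun x =>
    (Submodule.mem_torsionBySet_iff _ _).trans ⟨fun hx b hb => hx ⟨b, hb⟩, fun hx b => hx b b.2⟩
  -- evaluation at `1` identifies `Hom(A/I, E)` with `W`
  let ev : ((A ⧸ I) →ₗ[A] E) →ₗ[A] W :=
    (LinearMap.applyₗ (Submodule.Quotient.mk 1)).codRestrict W fun φ => (hW _).2 fun b hb => by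
      change b • φ _ = 0
      rw [← map_smul, ← Submodule.Quotient.mk_smul,
        (Submodule.Quotient.mk_eq_zero I).2 (by simpa using hb), map_zero]
  have hev : Function.Bijective ev := by
    constructor
    · intro φ ψ hφ
      have h1 : φ (Submodule.Quotient.mk 1) = ψ (Submodule.Quotient.mk 1) :=
        congrArg Subtype.val hφ
      refine Submodule.linearMap_qext I (LinearMap.ext_ring h1)
    · rintro ⟨x, hx⟩
      refine ⟨I.liftQ (LinearMap.toSpanSingleton A E x) fun b hb => (hW x).1 hx b hb, ?_⟩
      exact Subtype.ext (one_smul A x)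
  have hlenW : Module.length A W = Module.length A (A ⧸ I) := by
    rw [← (LinearEquiv.ofBijective ev hev).length_eq, h.length_dual hB]
  have hWfin : IsFiniteLength A W := by
    rw [← Module.length_ne_top_iff, hlenW]
    exact Module.length_ne_top_iff.2 hB
  -- `A/I` acts faithfully on `W`
  let μ : (A ⧸ I) →ₗ[A] (W →ₗ[A] E) :=
    I.liftQ (LinearMap.toSpanSingleton A _ W.subtype) fun b hb => by
      ext x
      exact (hW x).1 x.2 b hb
  have hμ : ∀ (a : A) (x : W), μ (Submodule.Quotient.mk a) x = a • (x : E) := fun a x => rfl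
  -- If `a` kills `W`, it kills `φ 1` for every `φ : A/I → E`, so each `φ` vanishes at the class of
  -- `a`, and that class is zero because `E` cogenerates.
  have hμinj : Function.Injective μ := by
    rw [← LinearMap.ker_eq_bot, Submodule.eq_bot_iff]
    intro y hy
    by_contra hne
    obtain ⟨a, rfl⟩ := Submodule.Quotient.mk_surjective I y
    obtain ⟨φ, hφ⟩ := h.exists_apply_ne_zero hne
    refine hφ ?_
    have h1 := LinearMap.congr_fun (LinearMap.mem_ker.1 hy) (ev φ)
    rw [hμ] at h1
    have h2 : a • φ (Submodule.Quotient.mk 1) = 0 := h1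
    rw [← map_smul, ← Submodule.Quotient.mk_smul, smul_eq_mul, mul_one] at h2
    exact h2
  -- Duality preserves length, so `A/I`, `W` and the dual of `W` have equal length and the injection
  -- `μ` is onto.
  obtain ⟨y, hy⟩ := surjective_of_injective_of_length_eq hB
    ((h.length_dual hWfin).trans hlenW).symm hμinj (f ∘ₗ W.subtype)
  obtain ⟨a, rfl⟩ := Submodule.Quotient.mk_surjective I y
  refine ⟨a, fun x hx => ?_⟩
  exact (LinearMap.congr_fun hy ⟨x, (hW x).2 hx⟩).symm

theorem IsInjectiveEnvelope.end_comm [IsNoetherianRing A] (h : IsInjectiveEnvelope j)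
    (f g : Module.End A E) : f * g = g * f := by
  ext x
  obtain ⟨n, hn⟩ := h.isPowerTorsion x
  obtain ⟨a, ha⟩ := h.exists_smul_eq n f
  obtain ⟨b, hb⟩ := h.exists_smul_eq n g
  change f (g x) = g (f x)
  rw [ha x hn, hb x hn, map_smul, map_smul, ha x hn, hb x hn, smul_comm]

/-- For a complete Noetherian local ring, `A` is the endomorphism ring of `E`. -/
theorem IsInjectiveEnvelope.bijective_toEnd [IsNoetherianRing A] (h : IsInjectiveEnvelope j)
    [IsAdicComplete (maximalIdeal A) A] :
    Function.Bijective (fun a : A => (a • LinearMap.id : E →ₗ[A] E)) := by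
  -- Anything killing all of the `𝔪ⁿ`-torsion of `E` lies in `𝔪ⁿ`. This yields injectivity by
  -- Krull's intersection theorem, and below the Cauchy condition on the scalars approximating `f`.
  have hann : ∀ (n : ℕ) (a : A), (∀ x : E, (∀ b ∈ maximalIdeal A ^ n, b • x = 0) → a • x = 0) →
      a ∈ maximalIdeal A ^ n := by
    intro n a ha
    by_contra hne
    obtain ⟨φ, hφ⟩ := h.exists_apply_ne_zero
      (mt (Submodule.Quotient.mk_eq_zero (maximalIdeal A ^ n)).1 hne)
    refine hφ ?_
    have : (Submodule.Quotient.mk a : A ⧸ maximalIdeal A ^ n) = a • Submodule.Quotient.mk 1 := by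
      rw [← Submodule.Quotient.mk_smul, smul_eq_mul, mul_one]
    rw [this, map_smul]
    refine ha _ fun b hb => ?_
    rw [← map_smul, ← Submodule.Quotient.mk_smul,
      (Submodule.Quotient.mk_eq_zero _).2 (by simpa using hb), map_zero]
  constructor
  · intro a b hab
    have hmem : ∀ n, a - b ∈ maximalIdeal A ^ n := fun n => hann n _ fun x _ => by
      rw [sub_smul, sub_eq_zero]
      exact LinearMap.congr_fun hab x
    have := Ideal.iInf_pow_eq_bot_of_isLocalRing (maximalIdeal A) (maximalIdeal.isMaximal A).ne_top
    rw [← sub_eq_zero, ← Submodule.mem_bot A, ← this]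
    exact (Submodule.mem_iInf _).2 hmem
  · intro f
    choose a ha using fun n => h.exists_smul_eq n f
    obtain ⟨L, hL⟩ := IsPrecomplete.prec (I := maximalIdeal A) (M := A) inferInstance (f := a) (by
      intro m n hmn
      rw [SModEq.sub_mem, smul_eq_mul, Ideal.mul_top]
      refine hann m _ fun x hx => ?_
      rw [sub_smul, ← ha m x hx,
        ← ha n x fun b hb => hx b (Ideal.pow_le_pow_right hmn hb), sub_self])
    refine ⟨L, LinearMap.ext fun x => ?_⟩
    obtain ⟨n, hn⟩ := h.isPowerTorsion x
    have h1 := hL n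
    rw [SModEq.sub_mem, smul_eq_mul, Ideal.mul_top] at h1
    have h2 := hn _ h1
    rw [sub_smul, sub_eq_zero] at h2
    rw [ha n x hn, h2]
    rfl

end Endomorphisms

/-! ### Local rings in which finite subsets of the maximal ideal have an annihilator -/

/-- Every finite subset of the maximal ideal is killed by a non-zero element. -/
def IsLocalRing.FinsetsAnnihilated (R : Type u) [CommRing R] [IsLocalRing R] : Prop :=
  ∀ s : Finset R, (∀ x ∈ s, x ∈ maximalIdeal R) → ∃ c : R, c ≠ 0 ∧ ∀ x ∈ s, c * x = 0

/-- Treat the elements one at a time, multiplying `c` by the last power of `x` that leaves it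
non-zero. -/
theorem IsLocalRing.finsetsAnnihilated_of_isNilpotent {R : Type u} [CommRing R] [IsLocalRing R]
    (h : ∀ x ∈ maximalIdeal R, IsNilpotent x) : FinsetsAnnihilated R := by
  classical
  intro s
  induction s using Finset.induction_on with
  | empty => exact fun _ => ⟨1, one_ne_zero, by simp⟩
  | insert x s _ ih =>
    intro hs
    obtain ⟨c, hc, hcs⟩ := ih fun y hy => hs y (Finset.mem_insert_of_mem hy)
    have hex : ∃ n, c * x ^ n = 0 := by
      obtain ⟨n, hn⟩ := h x (hs x (Finset.mem_insert_self x s))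
      exact ⟨n, by rw [hn, mul_zero]⟩
    have hpos : Nat.find hex ≠ 0 := fun h0 => hc <| by
      have := Nat.find_spec hex
      rwa [h0, pow_zero, mul_one] at this
    refine ⟨c * x ^ (Nat.find hex - 1), Nat.find_min hex (by omega), fun y hy => ?_⟩
    rcases Finset.mem_insert.1 hy with rfl | hy
    · rw [mul_assoc, ← pow_succ, Nat.sub_add_cancel (by omega)]
      exact Nat.find_spec hex
    · rw [mul_right_comm, hcs y hy, zero_mul]

/-- The maximal ideal of the localization is its nilradical. No Noetherian hypothesis enters, so
this applies directly to the endomorphism ring of `E`. -/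
theorem IsLocalRing.finsetsAnnihilated_of_mem_minimalPrimes {S : Type u} [CommRing S] {p : Ideal S}
    [p.IsPrime] (hp : p ∈ minimalPrimes S) : FinsetsAnnihilated (Localization.AtPrime p) := by
  refine finsetsAnnihilated_of_isNilpotent fun x hx => ?_
  rw [← Localization.AtPrime.map_eq_maximalIdeal,
    ← IsLocalization.AtPrime.radical_map_of_mem_minimalPrimes (Localization.AtPrime p) p ⊥ hp,
    Ideal.map_bot] at hx
  exact hx

/-- The element with annihilator `p` stays non-zero in the localization and kills the whole maximal
ideal. -/
theorem IsLocalRing.finsetsAnnihilated_of_mem_associatedPrimes {S : Type u} [CommRing S]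
    [IsNoetherianRing S] {p : Ideal S} [p.IsPrime] (hp : p ∈ associatedPrimes S S) :
    FinsetsAnnihilated (Localization.AtPrime p) := by
  obtain ⟨-, a, ha⟩ := isAssociatedPrime_iff.1 hp
  have hmem : ∀ b, b ∈ p ↔ b * a = 0 := fun b => by
    rw [ha, Submodule.mem_colon_singleton, smul_eq_mul, Submodule.mem_bot]
  intro s hs
  refine ⟨algebraMap S _ a, fun h0 => ?_, fun x hx => ?_⟩
  · obtain ⟨t, ht⟩ := (IsLocalization.map_eq_zero_iff p.primeCompl (Localization.AtPrime p) a).1 h0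
    exact t.2 ((hmem t).2 ht)
  · have hx' := hs x hx
    rw [← Localization.AtPrime.map_eq_maximalIdeal] at hx'
    refine Submodule.span_induction (p := fun y _ => algebraMap S (Localization.AtPrime p) a * y = 0)
      ?_ (mul_zero _) (fun y z _ _ hy hz => by rw [mul_add, hy, hz, add_zero])
      (fun c y _ hy => by rw [smul_eq_mul, mul_left_comm, hy, mul_zero]) hx'
    rintro _ ⟨b, hb, rfl⟩
    rw [← map_mul, mul_comm, (hmem b).1 hb, map_zero]

/-! ### Cokernels of injections between finite free modules -/

section Free

variable {R : Type u} [CommRing R] [IsLocalRing R] {M N P : Type u} [AddCommGroup M] [Module R M]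
  [AddCommGroup N] [Module R N] [AddCommGroup P] [Module R P]

/-- If `f x` lies in `𝔪N`, some `c ≠ 0` kills its finitely many coordinates, so `c • x = 0` by
injectivity. Then no coordinate of `x` is a unit, that is, `x` lies in `𝔪M`. -/
theorem IsLocalRing.FinsetsAnnihilated.lTensor_injective (h : FinsetsAnnihilated R)
    [Module.Free R M] [Module.Free R N] [Module.Finite R N]
    {f : M →ₗ[R] N} (hf : Function.Injective f) :
    Function.Injective (f.lTensor (ResidueField R)) := by
  classical
  rw [← LinearMap.ker_eq_bot, Submodule.eq_bot_iff]
  intro t ht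
  obtain ⟨x, rfl⟩ := TensorProduct.mk_surjective R M (ResidueField R) Ideal.Quotient.mk_surjective t
  have h1 : f x ∈ LinearMap.ker (TensorProduct.mk R (R ⧸ maximalIdeal R) N 1) := ht
  change x ∈ LinearMap.ker (TensorProduct.mk R (R ⧸ maximalIdeal R) M 1)
  rw [LinearMap.ker_tensorProductMk] at h1 ⊢
  let bN := Module.Free.chooseBasis R N
  let bM := Module.Free.chooseBasis R M
  have h2 : ∀ i, bN.repr (f x) i ∈ maximalIdeal R := fun i => by
    refine Submodule.smul_induction_on h1 (fun a ha n _ => ?_) fun y z hy hz => ?_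
    · rw [map_smul, Finsupp.smul_apply, smul_eq_mul]
      exact Ideal.mul_mem_right _ _ ha
    · rw [map_add, Finsupp.add_apply]
      exact add_mem hy hz
  obtain ⟨c, hc, hcs⟩ := h (Finset.univ.image fun i => bN.repr (f x) i) (by
    intro y hy
    obtain ⟨i, -, rfl⟩ := Finset.mem_image.1 hy
    exact h2 i)
  have hcx : c • x = 0 := hf <| by
    rw [map_zero, map_smul]
    refine bN.repr.injective (Finsupp.ext fun i => ?_)
    rw [map_smul, Finsupp.smul_apply, map_zero, Finsupp.zero_apply]
    exact hcs _ (Finset.mem_image_of_mem _ (Finset.mem_univ i))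
  rw [← bM.linearCombination_repr x, Finsupp.linearCombination_apply]
  refine Submodule.sum_mem _ fun i _ => Submodule.smul_mem_smul ?_ Submodule.mem_top
  rw [mem_maximalIdeal, mem_nonunits_iff]
  intro hu
  refine hc ((hu.mul_left_eq_zero).1 ?_)
  have := congrArg (fun z => bM.repr z i) hcx
  simpa using this

/-- Over a local ring in which finite subsets of the maximal ideal have non-zero annihilators, the
cokernel of an injective map of finite free modules is free. -/
theorem IsLocalRing.FinsetsAnnihilated.free_of_exact (h : FinsetsAnnihilated R)
    [Module.Free R M] [Module.Finite R M] [Module.Free R N] [Module.Finite R N]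
    {f : M →ₗ[R] N} {g : N →ₗ[R] P} (hf : Function.Injective f) (hfg : Function.Exact f g)
    (hg : Function.Surjective g) :
    Module.Free R P ∧ Module.Finite R P ∧
      Module.finrank R N = Module.finrank R M + Module.finrank R P := by
  have hfree : Module.Free R P :=
    Module.free_of_lTensor_residueField_injective f g hg hfg (h.lTensor_injective hf)
  have hfin : Module.Finite R P := Module.Finite.of_surjective g hg
  refine ⟨hfree, hfin, ?_⟩
  obtain ⟨l, hl⟩ := Module.projective_lifting_property g LinearMap.id hg
  obtain ⟨e, -⟩ := hfg.splitSurjectiveEquiv hf ⟨l, hl⟩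
  rw [e.finrank_eq, Module.finrank_prod]

end Free

/-! ### The localized dual -/

/-- The localization at the prime `p` of `S` of the `S`-module `Hom_A(M, E)`. -/
abbrev LocalizedDual (A : Type u) [CommRing A] {S : Type u} [CommRing S] (p : Ideal S) [p.IsPrime]
    (E : Type u) [AddCommGroup E] [Module A E] [Module S E] [SMulCommClass A S E]
    (M : Type u) [AddCommGroup M] [Module A M] : Type u :=
  LocalizedModule p.primeCompl (M →ₗ[A] E)

/-- The localized dual of `M` is free of rank `r`. -/
def IsDualFreeOfRank (A : Type u) [CommRing A] {S : Type u} [CommRing S] (p : Ideal S) [p.IsPrime]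
    (E : Type u) [AddCommGroup E] [Module A E] [Module S E] [SMulCommClass A S E]
    (M : Type u) [AddCommGroup M] [Module A M] (r : ℕ) : Prop :=
  Module.Free (Localization.AtPrime p) (LocalizedDual A p E M) ∧
    Module.Finite (Localization.AtPrime p) (LocalizedDual A p E M) ∧
    Module.finrank (Localization.AtPrime p) (LocalizedDual A p E M) = r

section LocalizedDual

variable {A : Type u} [CommRing A] {S : Type u} [CommRing S] {p : Ideal S} [p.IsPrime]
  {E : Type u} [AddCommGroup E] [Module A E] [Module S E] [SMulCommClass A S E]
  {M N P : Type u} [AddCommGroup M] [Module A M] [AddCommGroup N] [Module A N]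
  [AddCommGroup P] [Module A P]

theorem IsDualFreeOfRank.unique {r s : ℕ} (h : IsDualFreeOfRank A p E M r)
    (h' : IsDualFreeOfRank A p E M s) : r = s := h.2.2.symm.trans h'.2.2

/-- In a short exact sequence `0 → M → N → P → 0`, freeness of the localized duals of `N` and `P`
passes to `M`, and the ranks are additive. -/
theorem IsDualFreeOfRank.of_exact (hp : FinsetsAnnihilated (Localization.AtPrime p))
    (hE : Module.Injective A E) {f : M →ₗ[A] N} {g : N →ₗ[A] P} (hf : Function.Injective f)
    (hfg : Function.Exact f g) (hg : Function.Surjective g) {n r : ℕ}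
    (hN : IsDualFreeOfRank A p E N n) (hP : IsDualFreeOfRank A p E P r) :
    ∃ m, IsDualFreeOfRank A p E M m ∧ n = r + m := by
  obtain ⟨_, _, rfl⟩ := hN
  obtain ⟨_, _, rfl⟩ := hP
  obtain ⟨h1, h2, h3⟩ := hp.free_of_exact
    (f := LocalizedModule.map p.primeCompl (LinearMap.lcomp S E g))
    (g := LocalizedModule.map p.primeCompl (LinearMap.lcomp S E f))
    (LocalizedModule.map_injective _ _ (fun φ ψ h => by
      ext x
      obtain ⟨y, rfl⟩ := hg x
      exact LinearMap.congr_fun h y))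
    (LocalizedModule.map_exact _ _ _ (fun φ => by
      exact LinearMap.exact_lcomp_of_exact_of_surjective E hfg hg φ))
    (LocalizedModule.map_surjective _ _ (by exact hE.lcomp_surjective hf))
  exact ⟨_, ⟨h1, h2, rfl⟩, h3⟩

theorem IsDualFreeOfRank.of_subsingleton [Subsingleton M] : IsDualFreeOfRank A p E M 0 := by
  have : Subsingleton (M →ₗ[A] E) := ⟨fun f g => LinearMap.ext fun x => by
    rw [Subsingleton.elim x 0, map_zero, map_zero]⟩
  have : Subsingleton (LocalizedDual A p E M) := LocalizedModule.subsingleton_iff.2 fun m =>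
    ⟨1, Submonoid.one_mem _, Subsingleton.elim _ _⟩
  exact ⟨inferInstance, inferInstance, Module.finrank_zero_of_subsingleton⟩

/-- `Hom_A(Eⁿ, E) ≅ Sⁿ` when `S` is the endomorphism ring of `E`. -/
theorem nonempty_dual_equiv_pi
    (hS : Function.Bijective (fun s : S => (s • LinearMap.id : E →ₗ[A] E))) {n : ℕ}
    (e : M ≃ₗ[A] (Fin n → E)) : Nonempty ((Fin n → S) ≃ₗ[S] (M →ₗ[A] E)) := by
  let e₀ : S ≃ₗ[S] (E →ₗ[A] E) := LinearEquiv.ofBijective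
    (LinearMap.toSpanSingleton S (E →ₗ[A] E) LinearMap.id) hS
  let e₁ : (Fin n → S) ≃ₗ[S] (Fin n → (E →ₗ[A] E)) := LinearEquiv.piCongrRight fun _ => e₀
  let e₂ : (Fin n → (E →ₗ[A] E)) ≃ₗ[S] ((Fin n → E) →ₗ[A] E) :=
    LinearMap.lsum A (fun _ : Fin n => E) S
  let e₃ : ((Fin n → E) →ₗ[A] E) ≃ₗ[S] (M →ₗ[A] E) :=
    LinearEquiv.ofLinearMap (LinearMap.lcomp S E e.toLinearMap) (LinearMap.lcomp S E e.symm.toLinearMap)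
      (by ext; simp) (by ext; simp)
  exact ⟨e₁.trans (e₂.trans e₃)⟩

theorem IsDualFreeOfRank.of_equiv_pi
    (hS : Function.Bijective (fun s : S => (s • LinearMap.id : E →ₗ[A] E))) {n : ℕ}
    (e : M ≃ₗ[A] (Fin n → E)) : IsDualFreeOfRank A p E M n := by
  obtain ⟨e'⟩ := nonempty_dual_equiv_pi hS e
  have hfree : Module.Free S (M →ₗ[A] E) := Module.Free.of_equiv e'
  have hfin : Module.Finite S (M →ₗ[A] E) := Module.Finite.equiv e'
  have : Nontrivial S := (algebraMap S (Localization.AtPrime p)).domain_nontrivial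
  refine ⟨Module.free_of_isLocalizedModule p.primeCompl
      (LocalizedModule.mkLinearMap p.primeCompl (M →ₗ[A] E)),
    Module.Finite.of_isLocalizedModule p.primeCompl
      (LocalizedModule.mkLinearMap p.primeCompl (M →ₗ[A] E)), ?_⟩
  rw [Module.finrank_of_isLocalizedModule_of_free (Localization.AtPrime p) p.primeCompl
    (LocalizedModule.mkLinearMap p.primeCompl (M →ₗ[A] E)), ← e'.finrank_eq,
    Module.finrank_fin_fun]

end LocalizedDual

/-! ### Injective resolutions and their kernels -/

section Kernels

variable {A : Type u} [CommRing A] {G : Type u} [AddCommGroup G] [Module A G]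

/-- The kernel of `Iⁱ → Iⁱ⁺¹`. -/
abbrev cocycles (I : InjectiveResolution (ModuleCat.of A G)) (i : ℕ) :
    Submodule A (I.cocomplex.X i) :=
  LinearMap.ker (I.cocomplex.d i (i + 1)).hom

theorem range_d_eq_cocycles (I : InjectiveResolution (ModuleCat.of A G)) (i : ℕ) :
    LinearMap.range (I.cocomplex.d i (i + 1)).hom = cocycles I (i + 1) :=
  (LinearMap.exact_iff.1
    ((ShortComplex.ShortExact.moduleCat_exact_iff_function_exact _).1 (I.exact_succ i))).symm

/-- The map `Iⁱ → ker (Iⁱ⁺¹ → Iⁱ⁺²)` induced by the differential. -/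
def toCocycles (I : InjectiveResolution (ModuleCat.of A G)) (i : ℕ) :
    I.cocomplex.X i →ₗ[A] cocycles I (i + 1) :=
  (I.cocomplex.d i (i + 1)).hom.codRestrict _ fun x => by
    rw [← range_d_eq_cocycles]; exact ⟨x, rfl⟩

theorem toCocycles_surjective (I : InjectiveResolution (ModuleCat.of A G)) (i : ℕ) :
    Function.Surjective (toCocycles I i) := by
  rintro ⟨y, hy⟩
  rw [← range_d_eq_cocycles] at hy
  obtain ⟨x, rfl⟩ := hy
  exact ⟨x, rfl⟩

theorem exact_subtype_toCocycles (I : InjectiveResolution (ModuleCat.of A G)) (i : ℕ) :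
    Function.Exact (cocycles I i).subtype (toCocycles I i) := by
  intro x
  rw [Set.mem_range]
  exact ⟨fun h => ⟨⟨x, congrArg Subtype.val h⟩, rfl⟩, by
    rintro ⟨y, rfl⟩; exact Subtype.ext y.2⟩

/-- The augmentation `G → I⁰`. -/
noncomputable def augmentation (I : InjectiveResolution (ModuleCat.of A G)) : G →ₗ[A] I.cocomplex.X 0 :=
  (I.ι.f 0).hom

theorem augmentation_injective (I : InjectiveResolution (ModuleCat.of A G)) :
    Function.Injective (augmentation I) :=
  (ModuleCat.mono_iff_injective (I.ι.f 0)).1 inferInstance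

theorem range_augmentation (I : InjectiveResolution (ModuleCat.of A G)) :
    LinearMap.range (augmentation I) = cocycles I 0 := by
  have hex : (ShortComplex.mk (I.ι.f 0) (I.cocomplex.d 0 1) I.ι_f_zero_comp_complex_d).Exact :=
    ShortComplex.exact_of_f_is_kernel _ I.isLimitKernelFork
  exact (LinearMap.exact_iff.1
    ((ShortComplex.ShortExact.moduleCat_exact_iff_function_exact _).1 hex)).symm

theorem nonempty_equiv_cocycles_zero (I : InjectiveResolution (ModuleCat.of A G)) :
    Nonempty (G ≃ₗ[A] cocycles I 0) :=
  ⟨(LinearEquiv.ofInjective (augmentation I) (augmentation_injective I)).trans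
    (LinearEquiv.ofEq _ _ (range_augmentation I))⟩

theorem injective_X (I : InjectiveResolution (ModuleCat.of A G)) (i : ℕ) :
    Module.Injective A (I.cocomplex.X i) :=
  have : Injective (ModuleCat.of A (I.cocomplex.X i)) := I.injective i
  Module.injective_module_of_injective_object A _

/-- If `G` has finite injective dimension then some cocycle module of any injective resolution is
injective. -/
theorem exists_injective_cocycles (hG : FiniteInjectiveDimension A G)
    (I : InjectiveResolution (ModuleCat.of A G)) : ∃ N, Module.Injective A (cocycles I N) := by
  obtain ⟨N, hN⟩ := (injectiveDimension_ne_top_iff _).1 hG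
  -- Dimension shifting: each passage to the next cocycle module lowers the bound by one.
  have key : ∀ i k, i + k = N →
      HasInjectiveDimensionLT (ModuleCat.of A (cocycles I i)) (k + 1) := by
    intro i
    induction i with
    | zero =>
      intro k hk
      obtain ⟨e⟩ := nonempty_equiv_cocycles_zero I
      obtain rfl : k = N := by omega
      have : HasInjectiveDimensionLT (ModuleCat.of A G) (k + 1) := hN
      exact hasInjectiveDimensionLT_of_iso e.toModuleIso _
    | succ i ih =>
      intro k hk
      have h1 := ih (k + 1) (by omega)
      have hS : (ShortComplex.mk (ModuleCat.ofHom (cocycles I i).subtype)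
          (ModuleCat.ofHom (toCocycles I i)) (by
            ext x; exact congrArg Subtype.val ((exact_subtype_toCocycles I i _).2 ⟨x, rfl⟩))).ShortExact :=
        { exact := (ShortComplex.ShortExact.moduleCat_exact_iff_function_exact _).2
            (exact_subtype_toCocycles I i)
          mono_f := (ModuleCat.mono_iff_injective _).2 (cocycles I i).injective_subtype
          epi_g := (ModuleCat.epi_iff_surjective _).2 (toCocycles_surjective I i) }
      exact (hS.hasInjectiveDimensionLT_X₃_iff k (I.injective i)).2 h1
  refine ⟨N, ?_⟩
  have := injective_iff_hasInjectiveDimensionLT_one.2 (key N 0 rfl)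
  exact Module.injective_module_of_injective_object A (ModuleCat.of A (cocycles I N))

/-- In a minimal resolution of a module of finite injective dimension almost all terms vanish. -/
theorem IsMinimalResolution.exists_subsingleton (hG : FiniteInjectiveDimension A G)
    {I : InjectiveResolution (ModuleCat.of A G)} (hI : IsMinimalResolution I) :
    ∃ N : ℕ, ∀ i : ℕ, N < i → Subsingleton (I.cocomplex.X i) := by
  obtain ⟨N, hN⟩ := exists_injective_cocycles hG I
  have hstep : ∀ i, cocycles I i = ⊤ →
      cocycles I (i + 1) = ⊤ ∧ Subsingleton (I.cocomplex.X (i + 1)) := by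
    intro i hi
    have h0 : cocycles I (i + 1) = ⊥ := by
      rw [← range_d_eq_cocycles, LinearMap.range_eq_bot, ← LinearMap.ker_eq_top]
      exact hi
    -- By minimality the zero kernel is essential, so the whole term vanishes.
    have htop : (⊤ : Submodule A (I.cocomplex.X (i + 1))) = ⊥ := hI (i + 1) ⊤ (by
      rw [top_inf_eq]; exact h0)
    exact ⟨h0.trans htop.symm, (Submodule.subsingleton_iff A).1 (subsingleton_of_bot_eq_top htop.symm)⟩
  have htop : ∀ k, cocycles I (N + k) = ⊤ := fun k => by
    induction k with
    | zero => exact EssentialSubmodule.eq_top (hI N) hN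
    | succ k ih => exact (hstep _ ih).1
  refine ⟨N, fun i hi => ?_⟩
  obtain ⟨k, rfl⟩ := Nat.exists_eq_add_of_lt hi
  exact (hstep _ (htop k)).2

end Kernels

/-- An alternating sum of consecutive sums telescopes. -/
theorem finsum_alternating_eq {n r : ℕ → ℕ} {N : ℕ} (h : ∀ i, n i = r (i + 1) + r i)
    (hr : ∀ i, N < i → r i = 0) : ∑ᶠ i : ℕ, (-1 : ℤ) ^ i * (n i : ℤ) = r 0 := by
  have hsum : ∀ k, ∑ i ∈ Finset.range k, (-1 : ℤ) ^ i * (n i : ℤ) = r 0 - (-1) ^ k * r k := by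
    intro k
    induction k with
    | zero => simp
    | succ k ih => rw [Finset.sum_range_succ, ih, h, pow_succ]; push_cast; ring
  rw [finsum_eq_sum_of_support_subset (s := Finset.range (N + 1)), hsum, hr (N + 1) (by omega)]
  · simp
  · intro i hi
    rw [Finset.coe_range, Set.mem_Iio]
    by_contra hlt
    refine hi ?_
    change (-1 : ℤ) ^ i * (n i : ℤ) = 0
    rw [h, hr i (by omega), hr (i + 1) (by omega)]
    simp

theorem IsDualFreeOfRank.congr {A : Type u} [CommRing A] {S : Type u} [CommRing S] {p : Ideal S}
    [p.IsPrime] {E : Type u} [AddCommGroup E] [Module A E] [Module S E]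
    [SMulCommClass A S E] (hp : FinsetsAnnihilated (Localization.AtPrime p))
    (hE : Module.Injective A E) {M N : Type u} [AddCommGroup M] [Module A M]
    [AddCommGroup N] [Module A N] (e : M ≃ₗ[A] N) {r : ℕ} (h : IsDualFreeOfRank A p E N r) :
    IsDualFreeOfRank A p E M r := by
  -- The isomorphism is read as a short exact sequence with zero third term.
  obtain ⟨m, hm, rfl⟩ := IsDualFreeOfRank.of_exact (P := PUnit.{u + 1}) (f := e.toLinearMap)
    (g := 0) hp hE e.injective (fun x => ⟨fun _ => e.surjective x, fun _ => rfl⟩)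
    (fun x => ⟨0, Subsingleton.elim _ _⟩) h IsDualFreeOfRank.of_subsingleton
  rwa [zero_add]

/-! ### Resolutions by copies of the injective envelope of the residue field -/

section Local

variable {A : Type u} [CommRing A] [IsLocalRing A] {G : Type u}
  [AddCommGroup G] [Module A G]

/-- An Artinian cocycle module, being essential, makes its term a power of `E`; that term is then
Artinian, and so is its quotient, the next cocycle module. -/
theorem IsMinimalResolution.isFiniteResolutionByCopies [IsNoetherianRing A] [IsArtinian A G]
    (hG : FiniteInjectiveDimension A G)
    {I : InjectiveResolution (ModuleCat.of A G)} (hI : IsMinimalResolution I) :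
    IsFiniteResolutionByCopies I := by
  have hE := residueEnvelopeMap_isInjectiveEnvelope A
  have := hE.isArtinian
  have hX : ∀ i, IsArtinian A (cocycles I i) → ∃ n, IsSumOfCopies A (I.cocomplex.X i) n :=
    fun i _ => hE.exists_equiv_pi (injective_X I i) (hI i)
  have hZ : ∀ i, IsArtinian A (cocycles I i) := by
    intro i
    induction i with
    | zero =>
      obtain ⟨e⟩ := nonempty_equiv_cocycles_zero I
      exact isArtinian_of_linearEquiv e
    | succ i ih =>
      obtain ⟨n, ⟨e⟩⟩ := hX i ih
      have : IsArtinian A (I.cocomplex.X i) := isArtinian_of_linearEquiv e.symm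
      exact isArtinian_of_surjective _ (toCocycles I i) (toCocycles_surjective I i)
  exact ⟨hI.exists_subsingleton hG, fun i => hX i (hZ i)⟩

variable {S : Type u} [CommRing S] {p : Ideal S} [p.IsPrime] [Module S (residueEnvelope A)]
  [SMulCommClass A S (residueEnvelope A)]

/-- The exponent is recovered as the rank of the localized dual; any prime `p` will do. -/
theorem IsSumOfCopies.numCopies_eq
    (hS : Function.Bijective (fun s : S =>
      (s • LinearMap.id : residueEnvelope A →ₗ[A] residueEnvelope A)))
    (p : Ideal S) [p.IsPrime] {J : Type u} [AddCommGroup J] [Module A J] {n : ℕ}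
    (h : IsSumOfCopies A J n) : numCopies A J = n := by
  classical
  have hex : ∃ n, IsSumOfCopies A J n := ⟨n, h⟩
  rw [numCopies, dif_pos hex]
  obtain ⟨e⟩ := Nat.find_spec hex
  obtain ⟨e'⟩ := h
  exact (IsDualFreeOfRank.of_equiv_pi (p := p) hS e).unique
    (IsDualFreeOfRank.of_equiv_pi (p := p) hS e')

/-- The alternating sum of a finite resolution by copies of `E` is the rank of the localized
dual. -/
theorem IsFiniteResolutionByCopies.isDualFreeOfRank
    (hS : Function.Bijective (fun s : S =>
      (s • LinearMap.id : residueEnvelope A →ₗ[A] residueEnvelope A)))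
    (hp : FinsetsAnnihilated (Localization.AtPrime p))
    {I : InjectiveResolution (ModuleCat.of A G)} (hI : IsFiniteResolutionByCopies I) :
    ∃ r : ℕ, IsDualFreeOfRank A p (residueEnvelope A) G r ∧ alternatingSum I = r := by
  have hE := (residueEnvelopeMap_isInjectiveEnvelope A).isInjective
  obtain ⟨N, hN⟩ := hI.finite
  have hX : ∀ i, IsDualFreeOfRank A p (residueEnvelope A) (I.cocomplex.X i)
      (numCopies A (I.cocomplex.X i)) := fun i => by
    obtain ⟨n, hn⟩ := hI.copies i
    rw [hn.numCopies_eq hS p]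
    obtain ⟨e⟩ := hn
    exact .of_equiv_pi hS e
  have hzero : ∀ i, N < i → IsDualFreeOfRank A p (residueEnvelope A) (cocycles I i) 0 :=
    fun i hi => by
      have := hN i hi
      exact .of_subsingleton
  -- Descending induction from the vanishing terms, with `k` bounding the distance to them.
  have hZ : ∀ k i, N < i + k → ∃ r, IsDualFreeOfRank A p (residueEnvelope A) (cocycles I i) r := by
    intro k
    induction k with
    | zero => exact fun i hi => ⟨0, hzero i hi⟩
    | succ k ih =>
      intro i hi
      obtain ⟨r, hr⟩ := ih (i + 1) (by omega)
      obtain ⟨m, hm, -⟩ := IsDualFreeOfRank.of_exact hp hE (cocycles I i).injective_subtype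
        (exact_subtype_toCocycles I i) (toCocycles_surjective I i) (hX i) hr
      exact ⟨m, hm⟩
  choose r hr using fun i => hZ (N + 1) i (by omega)
  obtain ⟨e⟩ := nonempty_equiv_cocycles_zero I
  refine ⟨r 0, (hr 0).congr hp hE e, finsum_alternating_eq (N := N) (fun i => ?_) fun i hi =>
    (hr i).unique (hzero i hi)⟩
  obtain ⟨m, hm, hadd⟩ := IsDualFreeOfRank.of_exact hp hE (cocycles I i).injective_subtype
    (exact_subtype_toCocycles I i) (toCocycles_surjective I i) (hX i) (hr (i + 1))
  rw [hadd, hm.unique (hr i)]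

end Local

/-! ### Minimal injective resolutions -/

section Minimal

variable (A : Type u) [CommRing A]

/-- The injective envelope of a module. -/
noncomputable def injectiveHull (M : ModuleCat.{u} A) : ModuleCat.{u} A :=
  (exists_isInjectiveEnvelope A M).choose

/-- The embedding of a module in its injective envelope. -/
noncomputable def injectiveHullMap (M : ModuleCat.{u} A) : M →ₗ[A] injectiveHull A M :=
  (exists_isInjectiveEnvelope A M).choose_spec.choose

theorem injectiveHullMap_isInjectiveEnvelope (M : ModuleCat.{u} A) :
    IsInjectiveEnvelope (injectiveHullMap A M) :=
  (exists_isInjectiveEnvelope A M).choose_spec.choose_spec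

/-- The cosyzygies of a module in its minimal injective resolution. -/
noncomputable def cosyzygy (M : ModuleCat.{u} A) : ℕ → ModuleCat.{u} A
  | 0 => M
  | n + 1 => ModuleCat.of A
      (injectiveHull A (cosyzygy M n) ⧸ LinearMap.range (injectiveHullMap A (cosyzygy M n)))

/-- The projection of the injective envelope of a cosyzygy to the next cosyzygy. -/
noncomputable def toCosyzygy (M : ModuleCat.{u} A) (n : ℕ) :
    injectiveHull A (cosyzygy A M n) →ₗ[A] cosyzygy A M (n + 1) :=
  (LinearMap.range (injectiveHullMap A (cosyzygy A M n))).mkQ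

theorem toCosyzygy_surjective (M : ModuleCat.{u} A) (n : ℕ) :
    Function.Surjective (toCosyzygy A M n) := Submodule.mkQ_surjective _

theorem ker_toCosyzygy (M : ModuleCat.{u} A) (n : ℕ) :
    LinearMap.ker (toCosyzygy A M n) = LinearMap.range (injectiveHullMap A (cosyzygy A M n)) :=
  Submodule.ker_mkQ _

/-- The differential of the minimal injective resolution. -/
noncomputable def minimalD (M : ModuleCat.{u} A) (n : ℕ) :
    injectiveHull A (cosyzygy A M n) ⟶ injectiveHull A (cosyzygy A M (n + 1)) :=
  ModuleCat.ofHom (injectiveHullMap A (cosyzygy A M (n + 1)) ∘ₗ toCosyzygy A M n)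

theorem ker_minimalD (M : ModuleCat.{u} A) (n : ℕ) :
    LinearMap.ker (minimalD A M n).hom =
      LinearMap.range (injectiveHullMap A (cosyzygy A M n)) := by
  rw [← ker_toCosyzygy]
  exact LinearMap.ker_comp_of_ker_eq_bot _
    (LinearMap.ker_eq_bot.2 (injectiveHullMap_isInjectiveEnvelope A _).injective)

theorem range_minimalD (M : ModuleCat.{u} A) (n : ℕ) :
    LinearMap.range (minimalD A M n).hom =
      LinearMap.range (injectiveHullMap A (cosyzygy A M (n + 1))) :=
  LinearMap.range_comp_of_range_eq_top _ (LinearMap.range_eq_top.2 (toCosyzygy_surjective A M n))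

theorem minimalD_exact (M : ModuleCat.{u} A) (n : ℕ) :
    Function.Exact (minimalD A M n).hom (minimalD A M (n + 1)).hom :=
  LinearMap.exact_iff.2 ((ker_minimalD A M (n + 1)).trans (range_minimalD A M n).symm)

theorem minimalD_comp (M : ModuleCat.{u} A) (n : ℕ) :
    minimalD A M n ≫ minimalD A M (n + 1) = 0 := by
  ext x
  exact (minimalD_exact A M n).apply_apply_eq_zero x

/-- The minimal injective resolution, as a complex. -/
noncomputable def minimalComplex (M : ModuleCat.{u} A) : CochainComplex (ModuleCat.{u} A) ℕ :=
  CochainComplex.of (fun n => injectiveHull A (cosyzygy A M n)) (minimalD A M) (minimalD_comp A M)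

theorem minimalComplex_d (M : ModuleCat.{u} A) (n : ℕ) :
    (minimalComplex A M).d n (n + 1) = minimalD A M n :=
  CochainComplex.of_d (fun n => injectiveHull A (cosyzygy A M n)) (minimalD A M) n

theorem minimalComplex_exactAt_succ (M : ModuleCat.{u} A) (n : ℕ) :
    (minimalComplex A M).ExactAt (n + 1) := by
  rw [HomologicalComplex.exactAt_iff' _ n (n + 1) (n + 1 + 1) (by simp) (by simp),
    ShortComplex.ShortExact.moduleCat_exact_iff_function_exact]
  change Function.Exact ((minimalComplex A M).d n (n + 1)).hom
    ((minimalComplex A M).d (n + 1) (n + 1 + 1)).hom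
  rw [minimalComplex_d, minimalComplex_d]
  exact minimalD_exact A M n

theorem injectiveHullMap_exact (M : ModuleCat.{u} A) :
    Function.Exact (injectiveHullMap A M) (minimalD A M 0).hom :=
  LinearMap.exact_iff.2 (ker_minimalD A M 0)

theorem injectiveHullMap_comp (M : ModuleCat.{u} A) :
    ModuleCat.ofHom (injectiveHullMap A M) ≫ (minimalComplex A M).d 0 1 = 0 := by
  rw [minimalComplex_d]
  ext x
  exact (injectiveHullMap_exact A M).apply_apply_eq_zero x

/-- The augmentation of the minimal injective resolution. -/
noncomputable def minimalι (M : ModuleCat.{u} A) :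
    (CochainComplex.single₀ (ModuleCat.{u} A)).obj M ⟶ minimalComplex A M :=
  (CochainComplex.fromSingle₀Equiv _ _).symm
    ⟨ModuleCat.ofHom (injectiveHullMap A M), injectiveHullMap_comp A M⟩

theorem minimalι_f_zero (M : ModuleCat.{u} A) :
    (minimalι A M).f 0 = ModuleCat.ofHom (injectiveHullMap A M) :=
  CochainComplex.fromSingle₀Equiv_symm_apply_f_zero _ (injectiveHullMap_comp A M)

/-- The minimal injective resolution of a module. -/
noncomputable def minimalResolution (M : ModuleCat.{u} A) : InjectiveResolution M where
  cocomplex := minimalComplex A M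
  injective n := by
    have := (injectiveHullMap_isInjectiveEnvelope A (cosyzygy A M n)).isInjective
    exact Module.injective_object_of_injective_module A (injectiveHull A (cosyzygy A M n))
  ι := minimalι A M
  -- In degree zero this says that `M` embeds as the kernel of the first differential; in positive
  -- degrees, that the complex is exact.
  quasiIso := ⟨fun n => by
    cases n
    · rw [CochainComplex.quasiIsoAt₀_iff, ShortComplex.quasiIso_iff_of_zeros]
      · refine (ShortComplex.exact_and_mono_f_iff_of_iso
          (S₂ := ShortComplex.mk (ModuleCat.ofHom (injectiveHullMap A M)) 
            ((minimalComplex A M).d 0 1) (injectiveHullMap_comp A M)) ?_).2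
          ⟨(ShortComplex.ShortExact.moduleCat_exact_iff_function_exact _).2 (by
              change Function.Exact (injectiveHullMap A M) ((minimalComplex A M).d 0 1).hom
              rw [minimalComplex_d]
              exact injectiveHullMap_exact A M),
            (ModuleCat.mono_iff_injective _).2
              (injectiveHullMap_isInjectiveEnvelope A M).injective⟩
        exact ShortComplex.isoMk (Iso.refl _) (Iso.refl _) (Iso.refl _)
          ((Category.id_comp _).trans
            ((minimalι_f_zero A M).symm.trans (Category.comp_id ((minimalι A M).f 0)).symm))
          ((Category.id_comp _).trans (Category.comp_id ((minimalComplex A M).d 0 1)).symm)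
      all_goals rfl
    · rw [quasiIsoAt_iff_exactAt]
      · apply minimalComplex_exactAt_succ
      · apply CochainComplex.exactAt_succ_single_obj⟩

theorem minimalResolution_isMinimalResolution {G : Type u} [AddCommGroup G] [Module A G] :
    IsMinimalResolution (minimalResolution A (ModuleCat.of A G)) := by
  intro i
  change EssentialSubmodule
    (LinearMap.ker ((minimalComplex A (ModuleCat.of A G)).d i (i + 1)).hom)
  rw [minimalComplex_d]
  have h := (injectiveHullMap_isInjectiveEnvelope A (cosyzygy A (ModuleCat.of A G) i)).essential
  rw [← ker_minimalD] at h
  exact h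

end Minimal

/-! ### The Euler number -/

section Euler

variable {A : Type u} [CommRing A] [IsLocalRing A] [IsNoetherianRing A]

theorem IsInjectiveEnvelope.nontrivial {A : Type u} [CommRing A] [IsLocalRing A] {E : Type u}
    [AddCommGroup E] [Module A E] {j : (A ⧸ maximalIdeal A) →ₗ[A] E} (h : IsInjectiveEnvelope j) :
    Nontrivial E :=
  have : Nontrivial (A ⧸ maximalIdeal A) :=
    Ideal.Quotient.nontrivial_iff.2 (maximalIdeal.isMaximal A).ne_top
  h.injective.nontrivial

/-- The endomorphism ring of the injective envelope of the residue field, as a commutative ring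
acting on it, together with one of its minimal primes. -/
theorem IsInjectiveEnvelope.exists_endomorphismRing {E : Type u} [AddCommGroup E] [Module A E]
    {j : (A ⧸ maximalIdeal A) →ₗ[A] E} (h : IsInjectiveEnvelope j) :
    ∃ (S : Type u) (_ : CommRing S) (_ : Module S E) (_ : SMulCommClass A S E) (p : Ideal S)
      (_ : p.IsPrime), FinsetsAnnihilated (Localization.AtPrime p) ∧
        Function.Bijective (fun s : S => (s • LinearMap.id : E →ₗ[A] E)) := by
  have := h.nontrivial
  -- The centre carries a commutative ring structure, and by `end_comm` it is all of the
  -- endomorphism ring. The maximal ideal only serves to find a minimal prime.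
  obtain ⟨q, hq⟩ := Ideal.exists_maximal (Subring.center (Module.End A E))
  have := hq.isPrime
  obtain ⟨p, hp, -⟩ := Ideal.exists_minimalPrimes_le (I := ⊥) (J := q) bot_le
  have := hp.1.1
  refine ⟨Subring.center (Module.End A E), inferInstance, inferInstance, inferInstance, p, this,
    finsetsAnnihilated_of_mem_minimalPrimes hp, fun f g hfg => ?_, fun f => ?_⟩
  · exact Subtype.ext (LinearMap.ext fun x => LinearMap.congr_fun hfg x)
  · exact ⟨⟨f, Subring.mem_center_iff.2 fun g => h.end_comm g f⟩, LinearMap.ext fun x => rfl⟩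

variable {G : Type u} [AddCommGroup G] [Module A G]

theorem exists_isFiniteResolutionByCopies [IsArtinian A G] (hG : FiniteInjectiveDimension A G) :
    ∃ I : InjectiveResolution (ModuleCat.of A G), IsFiniteResolutionByCopies I :=
  ⟨_, (minimalResolution_isMinimalResolution A).isFiniteResolutionByCopies hG⟩

section Ring

variable {S : Type u} [CommRing S] {p : Ideal S} [p.IsPrime] [Module S (residueEnvelope A)]
  [SMulCommClass A S (residueEnvelope A)]

/-- The bridge between Euler numbers and ranks. `S` and `p` stay free so that the prime can be
adapted to each application. -/
theorem exists_isDualFreeOfRank_eulerNumber [IsArtinian A G] (hG : FiniteInjectiveDimension A G)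
    (hS : Function.Bijective (fun s : S =>
      (s • LinearMap.id : residueEnvelope A →ₗ[A] residueEnvelope A)))
    (hp : FinsetsAnnihilated (Localization.AtPrime p)) :
    ∃ r : ℕ, IsDualFreeOfRank A p (residueEnvelope A) G r ∧ eulerNumber A G = r := by
  have hex := exists_isFiniteResolutionByCopies hG
  rw [eulerNumber, dif_pos hex]
  exact hex.choose_spec.isDualFreeOfRank hS hp

end Ring

theorem alternatingSum_eq_eulerNumber [IsArtinian A G] (hG : FiniteInjectiveDimension A G)
    {I : InjectiveResolution (ModuleCat.of A G)} (hI : IsFiniteResolutionByCopies I) :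
    alternatingSum I = eulerNumber A G := by
  obtain ⟨S, _, _, _, p, _, hp, hS⟩ :=
    (residueEnvelopeMap_isInjectiveEnvelope A).exists_endomorphismRing
  obtain ⟨r, hr, h⟩ := exists_isDualFreeOfRank_eulerNumber hG hS hp
  obtain ⟨s, hs, h'⟩ := hI.isDualFreeOfRank hS hp
  rw [h, h', hr.unique hs]

theorem eulerNumber_nonneg [IsArtinian A G] (hG : FiniteInjectiveDimension A G) :
    0 ≤ eulerNumber A G := by
  obtain ⟨S, _, _, _, p, _, hp, hS⟩ :=
    (residueEnvelopeMap_isInjectiveEnvelope A).exists_endomorphismRing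
  obtain ⟨r, -, h⟩ := exists_isDualFreeOfRank_eulerNumber hG hS hp
  rw [h]
  exact Int.natCast_nonneg r

theorem eulerNumber_eq_add [IsArtinian A G] (hG : FiniteInjectiveDimension A G)
    {G' G'' : Type u} [AddCommGroup G'] [Module A G'] [AddCommGroup G''] [Module A G'']
    [IsArtinian A G'] [IsArtinian A G''] (hG' : FiniteInjectiveDimension A G')
    (hG'' : FiniteInjectiveDimension A G'') {f : G' →ₗ[A] G} {g : G →ₗ[A] G''}
    (hf : Function.Injective f) (hfg : Function.Exact f g) (hg : Function.Surjective g) :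
    eulerNumber A G = eulerNumber A G' + eulerNumber A G'' := by
  have hE := residueEnvelopeMap_isInjectiveEnvelope A
  obtain ⟨S, _, _, _, p, _, hp, hS⟩ := hE.exists_endomorphismRing
  obtain ⟨r, hr, h⟩ := exists_isDualFreeOfRank_eulerNumber hG hS hp
  obtain ⟨r', hr', h'⟩ := exists_isDualFreeOfRank_eulerNumber hG' hS hp
  obtain ⟨r'', hr'', h''⟩ := exists_isDualFreeOfRank_eulerNumber hG'' hS hp
  obtain ⟨m, hm, hadd⟩ := IsDualFreeOfRank.of_exact hp hE.isInjective hf hfg hg hr hr''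
  rw [h, h', h'', hadd, hm.unique hr']
  push_cast
  ring

theorem isSumOfCopies_iff [IsArtinian A G] (hG : Module.Injective A G) (n : ℕ) :
    IsSumOfCopies A G n ↔ n = numCopies A G := by
  have hE := residueEnvelopeMap_isInjectiveEnvelope A
  obtain ⟨S, _, _, _, p, _, hp, hS⟩ := hE.exists_endomorphismRing
  have := hE.isArtinian
  obtain ⟨m, hm⟩ : ∃ m, IsSumOfCopies A G m := by
    have : IsArtinian A (⊤ : Submodule A G) := isArtinian_of_linearEquiv Submodule.topEquiv.symm
    exact hE.exists_equiv_pi hG (Z := ⊤) fun P hP => by rwa [inf_top_eq] at hP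
  refine ⟨fun h => (h.numCopies_eq hS p).symm, ?_⟩
  rintro rfl
  rwa [hm.numCopies_eq hS p]

/-- A module and its dual have the same annihilator. -/
theorem IsInjectiveEnvelope.annihilator_dual {A : Type u} [CommRing A] [IsLocalRing A] {E : Type u}
    [AddCommGroup E] [Module A E] {j : (A ⧸ maximalIdeal A) →ₗ[A] E} (h : IsInjectiveEnvelope j)
    (M : Type u) [AddCommGroup M] [Module A M] :
    Module.annihilator A (M →ₗ[A] E) = Module.annihilator A M := by
  ext a
  rw [Module.mem_annihilator, Module.mem_annihilator]
  constructor
  · intro ha x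
    by_contra hne
    obtain ⟨f, hf⟩ := h.exists_apply_ne_zero hne
    refine hf ?_
    rw [map_smul]
    exact LinearMap.congr_fun (ha f) x
  · intro ha f
    ext x
    rw [LinearMap.smul_apply, ← map_smul, ha x, map_zero, LinearMap.zero_apply]

/-- The dual of a module with a resolution by copies of `E` is finite when `A` is complete. -/
theorem finite_dual [IsAdicComplete (maximalIdeal A) A] [IsArtinian A G]
    (hG : FiniteInjectiveDimension A G) : Module.Finite A (G →ₗ[A] residueEnvelope A) := by
  have hE := residueEnvelopeMap_isInjectiveEnvelope A
  obtain ⟨I, hI⟩ := exists_isFiniteResolutionByCopies hG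
  obtain ⟨n, ⟨e⟩⟩ := hI.copies 0
  obtain ⟨e'⟩ := nonempty_dual_equiv_pi hE.bijective_toEnd e
  have : Module.Finite A (I.cocomplex.X 0 →ₗ[A] residueEnvelope A) := Module.Finite.equiv e'
  exact Module.Finite.of_surjective _ (hE.isInjective.lcomp_surjective (augmentation_injective I))

/-! ### Vanishing of the Euler number over a complete ring -/

theorem eulerNumber_eq_zero_of_annihilator_ne_bot [IsAdicComplete (maximalIdeal A) A]
    [IsArtinian A G] (hG : FiniteInjectiveDimension A G) (h : Module.annihilator A G ≠ ⊥) :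
    eulerNumber A G = 0 := by
  have hE := residueEnvelopeMap_isInjectiveEnvelope A
  obtain ⟨a, ha, ha0⟩ := Submodule.exists_mem_ne_zero_of_ne_bot h
  -- An associated prime containing the annihilator of `a`, so that `a` stays non-zero in the
  -- localization; a minimal prime need not have this property.
  obtain ⟨p, hp, hle⟩ := exists_le_isAssociatedPrime_of_isNoetherianRing A a ha0
  have := hp.1
  obtain ⟨r, ⟨hfree, _, hrank⟩, hr⟩ := exists_isDualFreeOfRank_eulerNumber hG hE.bijective_toEnd
    (finsetsAnnihilated_of_mem_associatedPrimes (p := p) hp)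
  rw [hr, ← hrank, Nat.cast_eq_zero]
  have ha1 : algebraMap A (Localization.AtPrime p) a ≠ 0 := fun h0 => by
    obtain ⟨t, ht⟩ := (IsLocalization.map_eq_zero_iff p.primeCompl (Localization.AtPrime p) a).1 h0
    exact t.2 (hle (Submodule.mem_colon_singleton.2 ht))
  suffices Subsingleton (LocalizedDual A p (residueEnvelope A) G) from
    Module.finrank_zero_of_subsingleton
  by_contra hns
  rw [not_subsingleton_iff_nontrivial] at hns
  let b := Module.Free.chooseBasis (Localization.AtPrime p)
    (LocalizedDual A p (residueEnvelope A) G)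
  obtain ⟨i⟩ := b.index_nonempty
  refine ha1 ?_
  have hkill : ∀ y : LocalizedDual A p (residueEnvelope A) G, a • y = 0 := fun y => by
    rw [← hE.annihilator_dual] at ha
    induction y using LocalizedModule.induction_on with
    | h m s => rw [LocalizedModule.smul'_mk, Module.mem_annihilator.1 ha m, LocalizedModule.zero_mk]
  have h1 : algebraMap A (Localization.AtPrime p) a • b i = 0 := by
    rw [algebraMap_smul]; exact hkill _
  have h2 := congrArg (fun z => b.repr z i) h1
  simp only [map_smul, Finsupp.smul_apply, Module.Basis.repr_self, Finsupp.single_eq_same,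
    map_zero, Finsupp.zero_apply, smul_eq_mul, mul_one] at h2
  exact h2

theorem exists_nonZeroDivisor_of_eulerNumber_eq_zero [IsAdicComplete (maximalIdeal A) A]
    [IsArtinian A G] (hG : FiniteInjectiveDimension A G) (h : eulerNumber A G = 0) :
    ∃ a ∈ Module.annihilator A G, a ∈ nonZeroDivisors A := by
  have hE := residueEnvelopeMap_isInjectiveEnvelope A
  have := finite_dual hG
  have hnot : ∀ p ∈ associatedPrimes A A, ¬ Module.annihilator A G ≤ p := by
    intro p hp hle
    have hprime := hp.1
    obtain ⟨r, ⟨hfree, _, hrank⟩, hr⟩ := exists_isDualFreeOfRank_eulerNumber hG hE.bijective_toEnd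
      (finsetsAnnihilated_of_mem_associatedPrimes (p := p) hp)
    have hr0 : r = 0 := by rw [h] at hr; exact_mod_cast hr.symm
    rw [hr0] at hrank
    have hsub : Subsingleton (LocalizedDual A p (residueEnvelope A) G) :=
      (Module.finrank_eq_zero_iff_of_free _ _).1 hrank
    -- The support of a finitely generated module is the zero locus of its annihilator.
    have hsupp : (⟨p, hprime⟩ : PrimeSpectrum A) ∈
        Module.support A (G →ₗ[A] residueEnvelope A) := by
      rw [Module.support_eq_zeroLocus, hE.annihilator_dual]
      exact hle
    exact Module.notMem_support_iff.2 hsub hsupp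
  by_contra hcon
  push Not at hcon
  -- Prime avoidance over the finitely many associated primes, whose union is the set of
  -- zero-divisors. The two `0`s name ideals exempt from primality; the exemption is not needed.
  obtain ⟨p, hp, hle⟩ := (Ideal.subset_union_prime_finite (associatedPrimes.finite A A)
    (f := id) 0 0 fun _ hp _ _ => hp.1).1 (show (Module.annihilator A G : Set A) ⊆
      ⋃ p ∈ associatedPrimes A A, (p : Set A) by
        rw [biUnion_associatedPrimes_eq_compl_nonZeroDivisors]
        exact hcon)
  exact hnot p hp hle

end Euler

theorem proposition2p2 (A : Type u) [CommRing A] [IsNoetherianRing A] [IsLocalRing A]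
    (G : Type u) [AddCommGroup G] [Module A G] [IsArtinian A G]
    (hG : FiniteInjectiveDimension A G) :
    -- the number of copies in an Artinian injective module exists and is unique
    (∀ (J : Type u) [AddCommGroup J] [Module A J] [IsArtinian A J], Module.Injective A J →
      ∀ n : ℕ, IsSumOfCopies A J n ↔ n = numCopies A J) ∧
    -- a minimal injective resolution of `G` exists and has the required form
    (∃ I : InjectiveResolution (ModuleCat.of A G), IsMinimalResolution I) ∧
    (∀ I : InjectiveResolution (ModuleCat.of A G),
      IsMinimalResolution I → IsFiniteResolutionByCopies I) ∧
    -- (i) the alternating sum does not depend on the resolution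
    (∀ I : InjectiveResolution (ModuleCat.of A G), IsFiniteResolutionByCopies I →
      alternatingSum I = eulerNumber A G) ∧
    -- (ii) the Euler number is non-negative
    0 ≤ eulerNumber A G ∧
    -- (iii) the Euler number is additive on short exact sequences `0 → G' → G → G'' → 0`
    (∀ (G' G'' : Type u) [AddCommGroup G'] [Module A G'] [AddCommGroup G''] [Module A G'']
      [IsArtinian A G'] [IsArtinian A G''],
      FiniteInjectiveDimension A G' → FiniteInjectiveDimension A G'' →
      ∀ (f : G' →ₗ[A] G) (g : G →ₗ[A] G''),
        Function.Injective f → Function.Exact f g → Function.Surjective g →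
        eulerNumber A G = eulerNumber A G' + eulerNumber A G'') ∧
    -- (iv) the vanishing criterion over a complete local ring
    (IsAdicComplete (IsLocalRing.maximalIdeal A) A →
      [Module.annihilator A G ≠ ⊥,
        eulerNumber A G = 0,
        ∃ a ∈ Module.annihilator A G, a ∈ nonZeroDivisors A].TFAE) := by
  refine ⟨fun J _ _ _ hJ n => isSumOfCopies_iff hJ n,
    ⟨_, minimalResolution_isMinimalResolution A⟩,
    fun I hI => hI.isFiniteResolutionByCopies hG,
    fun I hI => alternatingSum_eq_eulerNumber hG hI,
    eulerNumber_nonneg hG,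
    fun G' G'' _ _ _ _ _ _ hG' hG'' f g hf hfg hg => eulerNumber_eq_add hG hG' hG'' hf hfg hg,
    fun _ => ?_⟩
  tfae_have 1 → 2 := eulerNumber_eq_zero_of_annihilator_ne_bot hG
  tfae_have 2 → 3 := exists_nonZeroDivisor_of_eulerNumber_eq_zero hG
  tfae_have 3 → 1 := by
    rintro ⟨a, ha, ha'⟩ hbot
    rw [hbot, Submodule.mem_bot] at ha
    exact nonZeroDivisors.ne_zero ha' ha
  tfae_finish
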